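/- Let $*:V(\mathbb{R})\to V(\mathbb{R}^{*})$ be a nonstandard extension of the superstructure $V(\mathbb{R})$ over the reals (a map carrying the set $\mathbb{R}$ to the set $\mathbb{R}^{*}$ of atoms of $V(\mathbb{R}^*)$ and satisfying the transfer principle for bounded formulas) that is $(2^{\mathfrak{c}})^{+}$-saturated: every family of at most $2^{\mathfrak{c}}$ internal sets with the finite intersection property has nonempty intersection. We regard $\mathbb{R}$ as a subset of $\mathbb{R}^{*}$ through $r\mapsto r^{*}$. Let $\mathfrak{F}(\mathbb{R},\mathbb{R})$ be the set of all functions $\mathbb{R}\to\mathbb{R}$, let $\Lambda$ be a hyperfinite subset of $\mathfrak{F}(\mathbb{R},\mathbb{R})^{*}$ containing $f^{*}$ for every $f\in\mathfrak{F}(\mathbb{R},\mathbb{R})$, let $\beta\in\mathbb{R}^{*}$ be a positive infinite number, write $[-\beta,\beta]=\{x\in\mathbb{R}^*: -\beta\le x\le\beta\}$, and let $$V_\Lambda=\{u|_{[-\beta,\beta]} : u\in \mathrm{Span}(\mathcal{C}^{1}(\mathbb{R})^{*}\cap\Lambda)\},$$ where $\mathrm{Span}$ is the internal linear span over $\mathbb{R}^*$.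 For $q\in[-\beta,\beta]$, a Delta ultrafunction centered in $q$ is an element $\delta_q\in V_\Lambda$ such that $$\int_{-\beta}^{\beta}v(x)\,\delta_q(x)\,dx=v(q)\qquad\text{for all } v\in V_\Lambda,$$ where the integral is the nonstandard extension of the Lebesgue integral. A set $\Sigma\subseteq[-\beta,\beta]$ is called independent if it indexes a Delta-basis of $V_\Lambda$, i.e. if there is an internal family $\{\delta_a\}_{a\in\Sigma}$ which is a basis (in the internal sense) of the internal $\mathbb{R}^{*}$-vector space $V_\Lambda$, with each $\delta_a$ a Delta ultrafunction centered in $a$. Theorem. There exists an independent set $\Sigma\subseteq[-\beta,\beta]$ such that $$\mathbb{R}\cup\{-\beta,\beta\}\subseteq\Sigma .$$ -/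

import Mathlib

universe u

/-! ## The superstructure over a set of atoms -/

/-- The levels of the superstructure over a set `X` of atoms: `V₀ = X` and, for `n ≥ 1`,
`Vₙ` consists of the atoms and of the subsets of `Vₙ₋₁`. -/
def SLevel (X : Type u) : ℕ → Type u
  | 0 => X
  | n + 1 => X ⊕ Set (SLevel X n)

/-- The inclusion of `Vₙ` in `Vₙ₊₁`. -/
def SLevel.up (X : Type u) : (n : ℕ) → SLevel X n → SLevel X (n + 1)
  | 0 => fun x => Sum.inl x
  | n + 1 => Sum.map id (Set.image (SLevel.up X n))

theorem SLevel.up_injective (X : Type u) : ∀ n, Function.Injective (SLevel.up X n)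
  | 0 => Sum.inl_injective
  | n + 1 => Sum.map_injective.2
      ⟨Function.injective_id, Set.image_injective.2 (SLevel.up_injective X n)⟩

/-- The inclusion of `Vᵢ` in `Vⱼ` for `i ≤ j`. -/
def SLevel.incl (X : Type u) (i j : ℕ) (h : i ≤ j) : SLevel X i ↪ SLevel X j :=
  ⟨Nat.leRecOn h (fun {k} => SLevel.up X k),
    Nat.leRecOn_injective h _ (fun n => SLevel.up_injective X n)⟩

instance SLevel.directedSystem (X : Type u) :
    DirectedSystem (SLevel X) (fun i j h => SLevel.incl X i j h) where
  map_self _ x := Nat.leRecOn_self x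
  map_map _ _ _ hij hjk x := (Nat.leRecOn_trans hij hjk x).symm

/-- The superstructure `V(X)`: the union of the levels `Vₙ`, i.e. their direct limit along the
inclusions. -/
def Superstructure (X : Type u) : Type u :=
  DirectLimit (SLevel X) (SLevel.incl X)

namespace Superstructure

variable {X : Type u}

/-- The inclusion of the level `Vₙ` in the superstructure. -/
def ofLevel (n : ℕ) (x : SLevel X n) : Superstructure X :=
  (⟦⟨n, x⟩⟧ : DirectLimit (SLevel X) (SLevel.incl X))

/-- An atom, as an element of the superstructure. -/
def atom (x : X) : Superstructure X := ofLevel 0 x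

/-- The set `s` of elements of `Vₙ`, as an element of the superstructure. -/
def levelSet (n : ℕ) (s : Set (SLevel X n)) : Superstructure X :=
  ofLevel (n + 1) (Sum.inr s : X ⊕ Set (SLevel X n))

/-- `y` is a set, not an atom. -/
def IsSet (y : Superstructure X) : Prop := ∃ n s, y = levelSet n s

/-- Membership in the superstructure; atoms have no elements. -/
instance : Membership (Superstructure X) (Superstructure X) where
  mem y x := ∃ (n : ℕ) (s : Set (SLevel X n)), y = levelSet n s ∧ x ∈ ofLevel n '' s

theorem ofLevel_injective (n : ℕ) : Function.Injective (ofLevel (X := X) n) :=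
  DirectLimit.mk_injective (SLevel.incl X) (fun i j h => (SLevel.incl X i j h).injective) n

theorem ofLevel_up (n : ℕ) (x : SLevel X n) :
    ofLevel (n + 1) (SLevel.up X n x) = ofLevel n x := by
  have h : SLevel.up X n x = SLevel.incl X n (n + 1) (Nat.le_succ n) x :=
    (Nat.leRecOn_succ' (C := SLevel X) (next := fun {k} => SLevel.up X k) x).symm
  rw [h]
  exact DirectLimit.mk_apply (f := SLevel.incl X) n (n + 1) x (Nat.le_succ n)

theorem range_ofLevel_mono {n m : ℕ} (h : n ≤ m) :
    Set.range (ofLevel (X := X) n) ⊆ Set.range (ofLevel (X := X) m) := by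
  induction m, h using Nat.le_induction with
  | base => exact subset_rfl
  | succ m _ ih =>
    refine ih.trans ?_
    rintro _ ⟨x, rfl⟩
    exact ⟨_, ofLevel_up m x⟩

theorem levelSet_lift {n m : ℕ} (h : n ≤ m) (s : Set (SLevel X n)) :
    ∃ t : Set (SLevel X m), levelSet m t = levelSet n s ∧ ofLevel m '' t = ofLevel n '' s := by
  induction m, h using Nat.le_induction with
  | base => exact ⟨s, rfl, rfl⟩
  | succ m _ ih =>
    obtain ⟨t, ht, ht'⟩ := ih
    refine ⟨SLevel.up X m '' t, ?_, ?_⟩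
    · rw [← ht]
      exact ofLevel_up (m + 1) (Sum.inr t : X ⊕ Set (SLevel X m))
    · rw [← ht', Set.image_image]
      simp only [ofLevel_up]

/-- Extensionality of membership in the superstructure, for sets given on two levels. -/
theorem levelSet_eq_iff {n m : ℕ} {s : Set (SLevel X n)} {t : Set (SLevel X m)} :
    levelSet n s = levelSet m t ↔ ofLevel n '' s = ofLevel m '' t := by
  obtain ⟨s', h1, h2⟩ := levelSet_lift (le_max_left n m) s
  obtain ⟨t', h3, h4⟩ := levelSet_lift (le_max_right n m) t
  rw [← h1, ← h2, ← h3, ← h4, (Set.image_injective.2 (ofLevel_injective _)).eq_iff]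
  constructor
  · intro h
    exact Sum.inr_injective (ofLevel_injective _ h)
  · rintro rfl
    rfl

theorem mem_levelSet {n : ℕ} {s : Set (SLevel X n)} {x : Superstructure X} :
    x ∈ levelSet n s ↔ x ∈ ofLevel n '' s := by
  constructor
  · rintro ⟨m, t, h, hx⟩
    rwa [levelSet_eq_iff.1 h]
  · intro h
    exact ⟨n, s, rfl, h⟩

theorem isSet_ext {x y : Superstructure X} (hx : IsSet x) (hy : IsSet y)
    (h : ∀ z, z ∈ x ↔ z ∈ y) : x = y := by
  obtain ⟨n, s, rfl⟩ := hx
  obtain ⟨m, t, rfl⟩ := hy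
  rw [levelSet_eq_iff]
  ext z
  rw [← mem_levelSet, ← mem_levelSet]
  exact h z

/-- A collection of elements of the superstructure is bounded if it lies in some level `Vₙ`. -/
def Bounded (A : Set (Superstructure X)) : Prop := ∃ n, A ⊆ Set.range (ofLevel n)

/-- The set in the superstructure whose elements are those of the bounded collection `A`. -/
noncomputable def mkSet (A : Set (Superstructure X)) (h : Bounded A) : Superstructure X :=
  levelSet h.choose (ofLevel h.choose ⁻¹' A)

theorem isSet_mkSet (A : Set (Superstructure X)) (h : Bounded A) : IsSet (mkSet A h) :=
  ⟨_, _, rfl⟩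

theorem mem_mkSet {A : Set (Superstructure X)} {h : Bounded A} {x : Superstructure X} :
    x ∈ mkSet A h ↔ x ∈ A := by
  rw [mkSet, mem_levelSet, Set.image_preimage_eq_of_subset h.choose_spec]

theorem mkSet_mem_range {A : Set (Superstructure X)} {h : Bounded A} {n : ℕ}
    (hA : A ⊆ Set.range (ofLevel n)) : mkSet A h ∈ Set.range (ofLevel (n + 1)) := by
  refine ⟨(Sum.inr (ofLevel n ⁻¹' A) : X ⊕ Set (SLevel X n)), ?_⟩
  change levelSet n _ = _
  apply isSet_ext ⟨_, _, rfl⟩ (isSet_mkSet A h)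
  intro z
  rw [mem_levelSet, mem_mkSet, Set.image_preimage_eq_of_subset hA]

theorem atom_injective : Function.Injective (atom (X := X)) := ofLevel_injective 0

theorem ofLevel_inl (n : ℕ) (x : X) :
    ofLevel (n + 1) (Sum.inl x : X ⊕ Set (SLevel X n)) = atom x := by
  induction n with
  | zero => exact ofLevel_up 0 x
  | succ n ih =>
    rw [← ih]
    exact ofLevel_up (n + 1) (Sum.inl x : X ⊕ Set (SLevel X n))

theorem not_isSet_atom (x : X) : ¬ IsSet (atom x) := by
  rintro ⟨n, s, h⟩
  exact Sum.inl_ne_inr (ofLevel_injective (n + 1) ((ofLevel_inl n x).trans h))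

theorem exists_level (x : Superstructure X) : ∃ n, x ∈ Set.range (ofLevel n) := by
  obtain ⟨n, a, h⟩ := DirectLimit.exists_eq_mk (SLevel.incl X) x
  exact ⟨n, a, h.symm⟩

theorem level_transitive {n : ℕ} {x y : Superstructure X} (hy : y ∈ Set.range (ofLevel n))
    (hx : x ∈ y) : x ∈ Set.range (ofLevel n) := by
  obtain ⟨a, rfl⟩ := hy
  cases n with
  | zero =>
    obtain ⟨m, s, h, -⟩ := hx
    exact absurd ⟨m, s, h⟩ (not_isSet_atom a)
  | succ n =>
    rcases a with a | s
    · obtain ⟨m, t, h, -⟩ := hx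
      exact absurd ⟨m, t, (ofLevel_inl n a).symm.trans h⟩ (not_isSet_atom a)
    · obtain ⟨b, -, rfl⟩ := mem_levelSet.1 (show x ∈ levelSet n s from hx)
      exact range_ofLevel_mono (Nat.le_succ n) ⟨b, rfl⟩

theorem bounded_mem (y : Superstructure X) : Bounded {x | x ∈ y} := by
  obtain ⟨n, hn⟩ := exists_level y
  exact ⟨n, fun _ hx => level_transitive hn hx⟩

theorem bounded_pair (a b : Superstructure X) : Bounded {a, b} := by
  obtain ⟨n, hn⟩ := exists_level a
  obtain ⟨m, hm⟩ := exists_level b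
  refine ⟨max n m, ?_⟩
  rintro x (rfl | rfl)
  · exact range_ofLevel_mono (le_max_left n m) hn
  · exact range_ofLevel_mono (le_max_right n m) hm

/-- The unordered pair `{a, b}`. -/
noncomputable def upair (a b : Superstructure X) : Superstructure X :=
  mkSet {a, b} (bounded_pair a b)

/-- The (Kuratowski) ordered pair `(a, b) = {{a}, {a, b}}`. -/
noncomputable def pair (a b : Superstructure X) : Superstructure X :=
  upair (upair a a) (upair a b)

theorem bounded_atoms : Bounded (Set.range (atom (X := X))) := ⟨0, subset_rfl⟩

variable (X) in
/-- The set of all atoms, as an element of the superstructure. -/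
noncomputable def base : Superstructure X := mkSet (Set.range atom) bounded_atoms

theorem bounded_sep (s : Superstructure X) (P : Set (Superstructure X)) :
    Bounded {x | x ∈ s ∧ x ∈ P} :=
  (bounded_mem s).imp fun _ h => fun _ hx => h hx.1

theorem bounded_empty : Bounded (∅ : Set (Superstructure X)) := ⟨0, Set.empty_subset _⟩

/-- The subset of the elements of `s` which lie in `P`. -/
noncomputable def sep (s : Superstructure X) (P : Set (Superstructure X)) : Superstructure X :=
  mkSet {x | x ∈ s ∧ x ∈ P} (bounded_sep s P)

open Classical in
/-- The value `F(x)` of a function `F` (a set of ordered pairs) at an element `x` of its domain;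
the empty set if `x` is not in the domain. -/
noncomputable def app (F x : Superstructure X) : Superstructure X :=
  if h : ∃ y, pair x y ∈ F then h.choose else mkSet ∅ bounded_empty

/-- The restriction of the function `u` to the domain `I`. -/
noncomputable def restr (u : Superstructure X) (I : Set (Superstructure X)) : Superstructure X :=
  sep u {p | ∃ x ∈ I, ∃ y, p = pair x y}

theorem bounded_restr (W : Superstructure X) (I : Set (Superstructure X)) :
    Bounded {w | ∃ u ∈ W, w = restr u I} := by
  obtain ⟨n, hn⟩ := exists_level W
  refine ⟨n + 1, ?_⟩
  rintro _ ⟨u, hu, rfl⟩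
  exact mkSet_mem_range (A := {x | x ∈ u ∧ x ∈ {p | ∃ x ∈ I, ∃ y, p = pair x y}})
    fun x hx => level_transitive (level_transitive hn hu) hx.1

/-- The set `{u|_I : u ∈ W}` of the restrictions to `I` of the functions in `W`. -/
noncomputable def restrAll (W : Superstructure X) (I : Set (Superstructure X)) :
    Superstructure X :=
  mkSet {w | ∃ u ∈ W, w = restr u I} (bounded_restr W I)

end Superstructure

/-! ## Coding of real objects in the superstructure over the reals -/

/-- A type whose elements are represented by elements of a level of the superstructure `V(ℝ)`. -/
class RealCode (α : Type) where
  /-- The element of `V(ℝ)` which represents an element of `α`. -/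
  code : α → Superstructure ℝ
  bounded : Superstructure.Bounded (Set.range code)

open Superstructure RealCode

/-- Real numbers are the atoms of `V(ℝ)`. -/
instance RealCode.instReal : RealCode ℝ := ⟨atom, bounded_atoms⟩

theorem RealCode.bounded_image {α : Type} [RealCode α] (A : Set α) : Bounded (code '' A) :=
  bounded.imp fun _ h => (Set.image_subset_range _ _).trans h

/-- A set is represented by the set of the codes of its elements. -/
noncomputable instance RealCode.instSet {α : Type} [RealCode α] : RealCode (Set α) where
  code A := mkSet (code '' A) (RealCode.bounded_image A)
  bounded := by
    obtain ⟨n, hn⟩ := bounded (α := α)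
    refine ⟨n + 1, ?_⟩
    rintro _ ⟨A, rfl⟩
    exact mkSet_mem_range ((Set.image_subset_range _ _).trans hn)

/-- A pair is represented by the ordered pair of the codes of its components. -/
noncomputable instance RealCode.instProd {α β : Type} [RealCode α] [RealCode β] :
    RealCode (α × β) where
  code p := pair (code p.1) (code p.2)
  bounded := by
    obtain ⟨n, hn⟩ := bounded (α := α)
    obtain ⟨m, hm⟩ := bounded (α := β)
    refine ⟨max n m + 2, ?_⟩
    rintro _ ⟨⟨a, b⟩, rfl⟩
    have ha := range_ofLevel_mono (le_max_left n m) (hn ⟨a, rfl⟩)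
    have hb := range_ofLevel_mono (le_max_right n m) (hm ⟨b, rfl⟩)
    refine mkSet_mem_range (h := bounded_pair _ _) ?_
    rintro x (rfl | rfl) <;> refine mkSet_mem_range (h := bounded_pair _ _) ?_ <;>
      rintro x (rfl | rfl) <;> assumption

/-! ## Nonstandard extensions -/

/-- Bounded formulas of the language of set theory, with variables `x₀, x₁, …`. -/
inductive BddFormula : Type
  /-- `xᵢ = xⱼ` -/
  | eq (i j : ℕ) : BddFormula
  /-- `xᵢ ∈ xⱼ` -/
  | mem (i j : ℕ) : BddFormula
  /-- `¬ φ` -/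
  | not (φ : BddFormula) : BddFormula
  /-- `φ ∧ ψ` -/
  | and (φ ψ : BddFormula) : BddFormula
  /-- `∀ xᵢ ∈ xⱼ, φ` -/
  | ball (i j : ℕ) (φ : BddFormula) : BddFormula

/-- The truth of a bounded formula in a superstructure, at given values of the variables. -/
def BddFormula.Holds {X : Type u} : BddFormula → (ℕ → Superstructure X) → Prop
  | .eq i j, v => v i = v j
  | .mem i j, v => v i ∈ v j
  | .not φ, v => ¬ φ.Holds v
  | .and φ ψ, v => φ.Holds v ∧ ψ.Holds v
  | .ball i j φ, v => ∀ x, x ∈ v j → φ.Holds (Function.update v i x)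

/-- A nonstandard extension of the superstructure `V(ℝ)`, whose field `ℝ*` of hyperreal numbers
has `Y` as its underlying set: a map `* : V(ℝ) → V(Y)` with `* ℝ = Y` which satisfies the
transfer principle for all bounded formulas with parameters. -/
structure NonstandardExtension (Y : Type u) where
  /-- The map `* : V(ℝ) → V(ℝ*)`. -/
  star : Superstructure ℝ → Superstructure Y
  star_base : star (base ℝ) = base Y
  transfer : ∀ (φ : BddFormula) (v : ℕ → Superstructure ℝ),
    φ.Holds v ↔ φ.Holds (fun i => star (v i))

/-! ## Standard objects -/

/-- The graph of a function `f : ℝ → ℝ`. -/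
def realGraph (f : ℝ → ℝ) : Set (ℝ × ℝ) := {p | p.2 = f p.1}

/-- The graph of a function `f : D → ℝ` on a set `D` of real numbers. -/
def graphOn {D : Set ℝ} (f : D → ℝ) : Set (ℝ × ℝ) := {p | ∃ x : D, p = ((x : ℝ), f x)}

/-- The set `𝔉(ℝ, ℝ)` of all functions from `ℝ` to `ℝ`. -/
def allFunctions : Set (Set (ℝ × ℝ)) := Set.range realGraph

/-- The set `C¹(ℝ)`. -/
def c1Functions : Set (Set (ℝ × ℝ)) := realGraph '' {f | ContDiff ℝ 1 f}

/-- The set of all finite sets of functions from `ℝ` to `ℝ`. -/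
def finiteFunctionSets : Set (Set (Set (ℝ × ℝ))) := {A | A ⊆ allFunctions ∧ A.Finite}

/-- The function `A ↦ Span A`, defined on the sets `A` of functions from `ℝ` to `ℝ`. -/
def spanFunction : Set (Set (Set (ℝ × ℝ)) × Set (Set (ℝ × ℝ))) :=
  {p | ∃ A : Set (ℝ → ℝ), p = (realGraph '' A, realGraph '' (Submodule.span ℝ A : Set (ℝ → ℝ)))}

/-- The function `(b, (u, v)) ↦ ∫_{-b}^{b} u(x) v(x) dx`, defined for `b > 0` and for functions
`u`, `v` on `[-b, b]` with integrable product. -/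
def innerFunction : Set ((ℝ × (Set (ℝ × ℝ) × Set (ℝ × ℝ))) × ℝ) :=
  {p | ∃ (b : ℝ) (u v : ℝ → ℝ), 0 < b ∧
    MeasureTheory.IntegrableOn (fun x => u x * v x) (Set.Icc (-b) b) ∧
    p = ((b, (graphOn (fun x : Set.Icc (-b) b => u x), graphOn (fun x : Set.Icc (-b) b => v x))),
      ∫ x in Set.Icc (-b) b, u x * v x)}

/-- The relation "the family `(e_a)_{a ∈ S}`, indexed by a set `S` of real numbers, is a basis of
the vector space `W` of real functions on a set `D` of real numbers". -/
def basisRelation : Set (Set (ℝ × Set (ℝ × ℝ)) × Set (Set (ℝ × ℝ))) :=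
  {p | ∃ (D S : Set ℝ) (e : S → (D → ℝ)) (W : Submodule ℝ (D → ℝ)),
    LinearIndependent ℝ e ∧ Submodule.span ℝ (Set.range e) = W ∧
    p = ({q | ∃ a : S, q = ((a : ℝ), graphOn (e a))}, graphOn '' (W : Set (D → ℝ)))}

/-! ## Ultrafunctions -/

namespace NonstandardExtension

variable {Y : Type u} (N : NonstandardExtension Y)

/-- The nonstandard extension of a real number, of a set of real numbers, and so on. -/
noncomputable def ext {α : Type} [RealCode α] (a : α) : Superstructure Y := N.star (code a)

/-- An element of `V(ℝ*)` is internal if it belongs to `B*` for some `B ∈ V(ℝ)`. -/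
def IsInternal (x : Superstructure Y) : Prop := ∃ B, x ∈ N.star B

/-- `κ⁺`-saturation: every family of at most `κ` internal sets with the finite intersection
property has a nonempty intersection. -/
def IsSaturated (κ : Cardinal.{u}) : Prop :=
  ∀ F : Set (Superstructure Y), (∀ A ∈ F, N.IsInternal A ∧ IsSet A) → Cardinal.mk F ≤ κ →
    (∀ G ⊆ F, G.Finite → ∃ x, ∀ A ∈ G, x ∈ A) → ∃ x, ∀ A ∈ F, x ∈ A

/-- The order relation `x < y` of the hyperreal numbers. -/
def HLt (x y : Superstructure Y) : Prop := pair x y ∈ N.ext {p : ℝ × ℝ | p.1 < p.2}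

/-- The order relation `x ≤ y` of the hyperreal numbers. -/
def HLe (x y : Superstructure Y) : Prop := pair x y ∈ N.ext {p : ℝ × ℝ | p.1 ≤ p.2}

/-- The hyperreal number `-x`. -/
noncomputable def hneg (x : Superstructure Y) : Superstructure Y :=
  app (N.ext {p : ℝ × ℝ | p.2 = -p.1}) x

/-- `β` is a positive infinite hyperreal number: `β > n` for every `n = 0, 1, 2, …`. -/
def IsPosInfinite (β : Superstructure Y) : Prop :=
  β ∈ base Y ∧ ∀ n : ℕ, N.HLt (N.ext (n : ℝ)) β

/-- The hyperreal interval `[-β, β]`. -/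
def interval (β : Superstructure Y) : Set (Superstructure Y) :=
  {x | x ∈ base Y ∧ N.HLe (N.hneg β) x ∧ N.HLe x β}

/-- `Λ` is a hyperfinite set of elements of `𝔉(ℝ, ℝ)*`. -/
def IsHyperfiniteFunctionSet (Λ : Superstructure Y) : Prop := Λ ∈ N.ext finiteFunctionSets

/-- The space `Span (C¹(ℝ)* ∩ Λ)`, where `Span` is the internal linear span. -/
noncomputable def c1Tilde (Λ : Superstructure Y) : Superstructure Y :=
  app (N.ext spanFunction) (sep (N.ext c1Functions) {u | u ∈ Λ})

/-- The space `V_Λ` of ultrafunctions. -/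
noncomputable def ultrafunctions (Λ β : Superstructure Y) : Superstructure Y :=
  restrAll (N.c1Tilde Λ) (N.interval β)

/-- `d` is a Delta ultrafunction centered in `q`: it belongs to `V_Λ`, and
`∫_{-β}^{β} v(x) d(x) dx = v(q)` for all `v ∈ V_Λ`. -/
def IsDelta (Λ β q d : Superstructure Y) : Prop :=
  d ∈ N.ultrafunctions Λ β ∧ ∀ v ∈ N.ultrafunctions Λ β,
    ∃ r, pair q r ∈ v ∧ pair (pair β (pair v d)) r ∈ N.ext innerFunction

/-- `d` is a Delta-basis `(δ_a)_{a ∈ S}` of `V_Λ`, indexed by a set `S ⊆ [-β, β]`: a function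
with domain `S`, which is a basis of `V_Λ` in the internal sense, and whose value at each `a ∈ S`
is a Delta ultrafunction centered in `a`. -/
def IsDeltaBasis (Λ β S d : Superstructure Y) : Prop :=
  IsSet S ∧ (∀ a ∈ S, a ∈ N.interval β) ∧
  (∀ a, a ∈ S ↔ ∃ e, pair a e ∈ d) ∧
  pair d (N.ultrafunctions Λ β) ∈ N.ext basisRelation ∧
  ∀ a e, pair a e ∈ d → N.IsDelta Λ β a e

/-- `S` is a set of independent points: it indexes a Delta-basis of `V_Λ`. -/
def IsIndependentSet (Λ β S : Superstructure Y) : Prop :=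
  ∃ d, N.IsDeltaBasis Λ β S d

end NonstandardExtension

/-! ## Further facts on the superstructure -/

namespace Superstructure

variable {X : Type u}

/-! By saturation it is enough to treat finitely many of the required points at a time. For each
point `x` of `ℝ ∪ {-β, β}`, the Delta-bases of the ultrafunction space whose index set contains `x`
form an internal set, and there are at most `𝔠` such points. A common element of all these sets is
an internal Delta-basis, and its index set is the required one. What remains is the finite
intersection property.

It is transferred from a standard fact, `exists_stdDeltaBasis`. On a finite-dimensional space of
continuous functions on `[-b, b]` the `L²` product is definite, so every evaluation at a point `a`
is represented by some `δ_a`. If each point of `F` has a function in the space that is nonzero there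
and zero on the rest of `F`, then the `δ_a` with `a ∈ F` are linearly independent. They extend to a
maximal independent family among all the `δ_a`. This family spans: a functional that kills every
`δ_a` is the product with some `f` vanishing at all points (`exists_basis_of_representing`).

The separating functions can be taken standard, hence in `Λ`: a bump around a standard point
vanishes at both infinite points, and a smooth step separates `β` or `-β` from the standard points
involved (`exists_separating`).

Transfer is organised by `Star α` (internal elements of a coded type), `T` (transferred predicates)
and `lift` (transferred functions). Bounded formulas are written out only for the basic rules of
this calculus; other predicates are then unfolded by `simp`. -/

theorem mem_upair {a b x : Superstructure X} : x ∈ upair a b ↔ x = a ∨ x = b := by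
  simp [upair, mem_mkSet]

theorem isSet_of_mem {x y : Superstructure X} (h : x ∈ y) : IsSet y := by
  obtain ⟨n, s, h, -⟩ := h
  exact ⟨n, s, h⟩

theorem eq_upair_iff {p a b : Superstructure X} :
    p = upair a b ↔ a ∈ p ∧ b ∈ p ∧ ∀ e ∈ p, e = a ∨ e = b := by
  constructor
  · rintro rfl
    simp [mem_upair]
  · rintro ⟨ha, hb, h⟩
    refine isSet_ext (isSet_of_mem ha) (isSet_mkSet _ _) fun z => ?_
    rw [mem_upair]
    exact ⟨h z, by rintro (rfl | rfl) <;> assumption⟩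

theorem upair_eq_iff {a b c d : Superstructure X} :
    upair a b = upair c d ↔ (a = c ∧ b = d) ∨ (a = d ∧ b = c) := by
  constructor
  · intro h
    have ha : a ∈ upair c d := h ▸ mem_upair.2 (Or.inl rfl)
    have hb : b ∈ upair c d := h ▸ mem_upair.2 (Or.inr rfl)
    have hc : c ∈ upair a b := h ▸ mem_upair.2 (Or.inl rfl)
    have hd : d ∈ upair a b := h ▸ mem_upair.2 (Or.inr rfl)
    rw [mem_upair] at ha hb hc hd
    grind
  · rintro (⟨rfl, rfl⟩ | ⟨rfl, rfl⟩)
    · rfl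
    · exact isSet_ext (isSet_mkSet _ _) (isSet_mkSet _ _) fun z =>
        mem_upair.trans (or_comm.trans mem_upair.symm)

theorem pair_eq_iff {a b c d : Superstructure X} :
    pair a b = pair c d ↔ a = c ∧ b = d := by
  simp only [pair, upair_eq_iff]
  grind

theorem mem_base {x : Superstructure X} : x ∈ base X ↔ x ∈ Set.range atom := mem_mkSet

theorem isSet_of_not_mem_base {x : Superstructure X} (h : x ∉ base X) : IsSet x := by
  obtain ⟨n, y, rfl⟩ := exists_level x
  cases n with
  | zero => exact absurd (mem_base.2 ⟨y, rfl⟩) h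
  | succ n =>
    rcases y with y | y
    · exact absurd (mem_base.2 ⟨y, (ofLevel_inl n y).symm⟩) h
    · exact ⟨n, y, rfl⟩

theorem not_mem_base_of_isSet {x : Superstructure X} (h : IsSet x) : x ∉ base X := by
  rw [mem_base]
  rintro ⟨y, rfl⟩
  exact not_isSet_atom y h

theorem app_eq_of_unique {F x y : Superstructure X} (h : pair x y ∈ F)
    (h' : ∀ z, pair x z ∈ F → z = y) : app F x = y := by
  rw [app, dif_pos ⟨y, h⟩]
  exact h' _ (Exists.choose_spec (p := fun z => pair x z ∈ F) ⟨y, h⟩)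

theorem mem_sep {s x : Superstructure X} {P : Set (Superstructure X)} :
    x ∈ sep s P ↔ x ∈ s ∧ x ∈ P := mem_mkSet

theorem mem_restr {u z : Superstructure X} {I : Set (Superstructure X)} :
    z ∈ restr u I ↔ z ∈ u ∧ ∃ x ∈ I, ∃ y, z = pair x y := mem_sep

theorem mem_restrAll {W w : Superstructure X} {I : Set (Superstructure X)} :
    w ∈ restrAll W I ↔ ∃ u ∈ W, w = restr u I := mem_mkSet

end Superstructure

/-! ## Bounded formulas -/

namespace BddFormula

variable {X : Type u}

/-- Implication of bounded formulas. -/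
def imp (φ ψ : BddFormula) : BddFormula := not (and φ (not ψ))

/-- Equivalence of bounded formulas. -/
def iff (φ ψ : BddFormula) : BddFormula := and (imp φ ψ) (imp ψ φ)

/-- Bounded existential quantification. -/
def bex (i j : ℕ) (φ : BddFormula) : BddFormula := not (ball i j (not φ))

/-- The formula `xₚ = {xₐ, x_b}`, with bound variable `12`. -/
def isUpair (p a b : ℕ) : BddFormula :=
  and (mem a p) (and (mem b p) (ball 12 p (not (and (not (eq 12 a)) (not (eq 12 b))))))

/-- The formula `xₚ = (xₐ, x_b)`, with bound variables `10`, `11`, `12`. -/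
def isPair (p a b : ℕ) : BddFormula :=
  bex 10 p (bex 11 p (and (isUpair p 10 11) (and (isUpair 10 a a) (isUpair 11 a b))))

/-- The formula `(xₐ, x_b) ∈ x_r`, with bound variables `9`, …, `12`. -/
def pairMem (a b r : ℕ) : BddFormula := bex 9 r (isPair 9 a b)

@[simp] theorem holds_eq {i j : ℕ} {v : ℕ → Superstructure X} :
    (eq i j).Holds v ↔ v i = v j := Iff.rfl

@[simp] theorem holds_mem {i j : ℕ} {v : ℕ → Superstructure X} :
    (mem i j).Holds v ↔ v i ∈ v j := Iff.rfl

@[simp] theorem holds_not {φ : BddFormula} {v : ℕ → Superstructure X} :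
    (not φ).Holds v ↔ ¬ φ.Holds v := Iff.rfl

@[simp] theorem holds_and {φ ψ : BddFormula} {v : ℕ → Superstructure X} :
    (and φ ψ).Holds v ↔ φ.Holds v ∧ ψ.Holds v := Iff.rfl

@[simp] theorem holds_ball {i j : ℕ} {φ : BddFormula} {v : ℕ → Superstructure X} :
    (ball i j φ).Holds v ↔ ∀ x ∈ v j, φ.Holds (Function.update v i x) := Iff.rfl

@[simp] theorem holds_imp {φ ψ : BddFormula} {v : ℕ → Superstructure X} :
    (imp φ ψ).Holds v ↔ (φ.Holds v → ψ.Holds v) := by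
  simp [imp]

@[simp] theorem holds_iff {φ ψ : BddFormula} {v : ℕ → Superstructure X} :
    (iff φ ψ).Holds v ↔ (φ.Holds v ↔ ψ.Holds v) := by
  simp [iff, iff_def]

@[simp] theorem holds_bex {i j : ℕ} {φ : BddFormula} {v : ℕ → Superstructure X} :
    (bex i j φ).Holds v ↔ ∃ x ∈ v j, φ.Holds (Function.update v i x) := by
  simp [bex]

/-- The bounds on `a` and `b` prevent capture by the bound variable `12`; `p` occurs only outside
its scope. -/
theorem holds_isUpair {p a b : ℕ} (ha : a < 12) (hb : b < 12)
    {v : ℕ → Superstructure X} : (isUpair p a b).Holds v ↔ v p = upair (v a) (v b) := by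
  rw [eq_upair_iff]
  simp only [isUpair, holds_and, holds_mem, holds_ball, holds_not, holds_eq,
    Function.update_self, Function.update_of_ne ha.ne, Function.update_of_ne hb.ne]
  simp only [not_and_or, not_not]

theorem holds_isPair {p a b : ℕ} (hp : p < 10) (ha : a < 10) (hb : b < 10)
    {v : ℕ → Superstructure X} : (isPair p a b).Holds v ↔ v p = pair (v a) (v b) := by
  have h10 {n : ℕ} (h : n < 10) (y z : Superstructure X) :
      Function.update (Function.update v 10 y) 11 z n = v n := by
    rw [Function.update_of_ne (by omega), Function.update_of_ne (by omega)]
  have h' {n : ℕ} (h : n < 10) (y : Superstructure X) :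
      Function.update v 10 y n = v n := Function.update_of_ne (by omega) _ _
  simp only [isPair, holds_bex, holds_and, h' hp,
    holds_isUpair (show (10 : ℕ) < 12 by omega) (show (11 : ℕ) < 12 by omega),
    holds_isUpair (show a < 12 by omega) (show a < 12 by omega),
    holds_isUpair (show a < 12 by omega) (show b < 12 by omega), h10 hp, h10 ha, h10 hb,
    Function.update_self, Function.update_of_ne (show (10 : ℕ) ≠ 11 by omega)]
  constructor
  · rintro ⟨c, -, d, -, h, rfl, rfl⟩
    exact h
  · intro h
    -- Both unordered pairs are elements of the ordered pair, so bounding the quantifiers by it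
    -- loses nothing.
    exact ⟨_, h ▸ mem_upair.2 (Or.inl rfl), _, h ▸ mem_upair.2 (Or.inr rfl), h, rfl, rfl⟩

theorem holds_pairMem {a b r : ℕ} (ha : a < 9) (hb : b < 9)
    {v : ℕ → Superstructure X} : (pairMem a b r).Holds v ↔ pair (v a) (v b) ∈ v r := by
  simp only [pairMem, holds_bex,
    holds_isPair (show (9 : ℕ) < 10 by omega) (show a < 10 by omega) (show b < 10 by omega),
    Function.update_self, Function.update_of_ne ha.ne, Function.update_of_ne hb.ne]
  simp

end BddFormula

/-! ## Codes -/

/-- Codings which are injective. -/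
class RealCode.Faithful (α : Type) [RealCode α] : Prop where
  inj : Function.Injective (code : α → Superstructure ℝ)

instance : Faithful ℝ := ⟨atom_injective⟩

theorem RealCode.mem_code_set {α : Type} [RealCode α] {A : Set α} {x : Superstructure ℝ} :
    x ∈ code A ↔ ∃ a ∈ A, code a = x := mem_mkSet

theorem RealCode.code_mem_code {α : Type} [RealCode α] [Faithful α] {A : Set α} {a : α} :
    code a ∈ code A ↔ a ∈ A := by
  rw [mem_code_set]
  exact Faithful.inj.mem_set_image

instance {α : Type} [RealCode α] [Faithful α] : Faithful (Set α) := ⟨fun A B h => by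
  ext a
  rw [← code_mem_code, ← code_mem_code (A := B), h]⟩

instance {α β : Type} [RealCode α] [Faithful α] [RealCode β] [Faithful β] :
    Faithful (α × β) := ⟨fun p q h => by
  obtain ⟨h1, h2⟩ := pair_eq_iff.1 h
  exact Prod.ext (Faithful.inj h1) (Faithful.inj h2)⟩

theorem RealCode.code_pair {α β : Type} [RealCode α] [RealCode β] (a : α) (b : β) :
    code (a, b) = pair (code a) (code b) := rfl

theorem RealCode.ball_code {α : Type} [RealCode α] {A : Set α} {p : Superstructure ℝ → Prop} :
    (∀ x ∈ code A, p x) ↔ ∀ a ∈ A, p (code a) := by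
  simp only [mem_code_set]
  grind

theorem RealCode.bex_code {α : Type} [RealCode α] {A : Set α} {p : Superstructure ℝ → Prop} :
    (∃ x, x ∈ code A ∧ p x) ↔ ∃ a ∈ A, p (code a) := by
  simp only [mem_code_set]
  grind

/-! ## The transfer principle on coded types -/

namespace NonstandardExtension

open BddFormula

variable {Y : Type u} (N : NonstandardExtension Y)

/-- A list of values, as a valuation of the variables. -/
def valuation {X : Type u} (d : Superstructure X) (l : List (Superstructure X)) (n : ℕ) :
    Superstructure X := l.getD n d

/-- Indices beyond the list take the default value, so the default has to be starred along with the
entries. -/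
theorem transfer_list (φ : BddFormula) (d : Superstructure ℝ) (l : List (Superstructure ℝ)) :
    φ.Holds (valuation d l) ↔ φ.Holds (valuation (N.star d) (l.map N.star)) := by
  rw [N.transfer]
  congr! 2 with i
  simp [valuation]

theorem star_mem {s t : Superstructure ℝ} : N.star s ∈ N.star t ↔ s ∈ t := by
  have := N.transfer_list (mem 0 1) s [s, t]
  simpa [valuation] using this.symm

theorem star_subset {s t : Superstructure ℝ} (h : ∀ x ∈ s, x ∈ t) {x : Superstructure Y}
    (hx : x ∈ N.star s) : x ∈ N.star t := by
  have := (N.transfer_list (ball 2 0 (mem 2 1)) s [s, t]).1 (by simpa [valuation] using h)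
  simp [valuation] at this
  exact this x hx

/-! ### Calculus of internal elements, predicates and functions -/

section

variable {α β γ : Type} [RealCode α] [Faithful α] [RealCode β] [Faithful β]
  [RealCode γ] [Faithful γ]

variable (α) in
/-- The internal elements of type `α`. -/
def Star : Type u := {x : Superstructure Y // x ∈ N.ext (Set.univ : Set α)}

omit [Faithful α] in
theorem star_ext_iff {x y : N.Star α} : x = y ↔ x.1 = y.1 := Subtype.ext_iff

/-- The nonstandard extension of a predicate. -/
def T (P : α → Prop) (x : N.Star α) : Prop := x.1 ∈ N.ext {a | P a}

theorem ext_mem_ext {a : α} {A : Set α} : N.ext a ∈ N.ext A ↔ a ∈ A :=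
  N.star_mem.trans code_mem_code

/-- A standard element, as an internal element. -/
noncomputable def std (a : α) : N.Star α := ⟨N.ext a, N.ext_mem_ext.2 trivial⟩

@[simp] theorem T_std {P : α → Prop} {a : α} : N.T P (N.std a) ↔ P a := N.ext_mem_ext

theorem mem_ext_univ {A : Set α} {x : Superstructure Y} (h : x ∈ N.ext A) :
    x ∈ N.ext (Set.univ : Set α) := by
  refine N.star_subset (fun x hx => ?_) h
  obtain ⟨a, -, rfl⟩ := mem_code_set.1 hx
  exact code_mem_code.2 trivial

-- The pattern for the rules below: one bounded formula relates the codes of the sets defined by the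
-- predicates, its quantifiers being bounded by the codes of whole types. It holds in `V(ℝ)` by
-- unfolding, and its transfer is read at `x`.
@[simp] theorem T_not {P : α → Prop} {x : N.Star α} : N.T (fun a => ¬ P a) x ↔ ¬ N.T P x := by
  have := (N.transfer_list (ball 3 0 (iff (mem 3 1) (not (mem 3 2)))) (code (Set.univ : Set α))
    [code (Set.univ : Set α), code {a | ¬ P a}, code {a | P a}]).1
    (by simp [valuation, ball_code, code_mem_code])
  simp [valuation] at this
  exact this x.1 x.2

@[simp] theorem T_and {P Q : α → Prop} {x : N.Star α} :
    N.T (fun a => P a ∧ Q a) x ↔ N.T P x ∧ N.T Q x := by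
  have := (N.transfer_list (ball 4 0 (iff (mem 4 1) (and (mem 4 2) (mem 4 3))))
    (code (Set.univ : Set α))
    [code (Set.univ : Set α), code {a | P a ∧ Q a}, code {a | P a}, code {a | Q a}]).1
    (by simp [valuation, ball_code, code_mem_code])
  simp [valuation] at this
  exact this x.1 x.2

omit [Faithful α] in
-- This is how standard theorems enter the calculus.
theorem T_of_forall {P : α → Prop} (h : ∀ a, P a) (x : N.Star α) : N.T P x := by
  have : {a | P a} = Set.univ := Set.eq_univ_of_forall h
  rw [T, this]
  exact x.2

@[simp] theorem T_imp {P Q : α → Prop} {x : N.Star α} :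
    N.T (fun a => P a → Q a) x ↔ (N.T P x → N.T Q x) := by
  have : (fun a => P a → Q a) = fun a => ¬ (P a ∧ ¬ Q a) := by
    ext a
    simp
  rw [this, T_not, T_and, T_not]
  tauto

@[simp] theorem T_or {P Q : α → Prop} {x : N.Star α} :
    N.T (fun a => P a ∨ Q a) x ↔ (N.T P x ∨ N.T Q x) := by
  have : (fun a => P a ∨ Q a) = fun a => ¬ P a → Q a := by
    ext a
    tauto
  rw [this, T_imp, T_not]
  tauto

@[simp] theorem T_iff {P Q : α → Prop} {x : N.Star α} :
    N.T (fun a => P a ↔ Q a) x ↔ (N.T P x ↔ N.T Q x) := by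
  simp only [iff_def, T_and, T_imp]

theorem pair_mem_univ (x : N.Star α) (y : N.Star β) :
    pair x.1 y.1 ∈ N.ext (Set.univ : Set (α × β)) := by
  have := (N.transfer_list (ball 3 0 (ball 4 1 (pairMem 3 4 2))) (code (Set.univ : Set α))
    [code (Set.univ : Set α), code (Set.univ : Set β), code (Set.univ : Set (α × β))]).1
    (by simp [valuation, ball_code, code_mem_code, holds_pairMem, ← code_pair])
  simp [valuation, holds_pairMem] at this
  exact this x.1 x.2 y.1 y.2

/-- The pair of two internal elements. -/
noncomputable def pr (x : N.Star α) (y : N.Star β) : N.Star (α × β) :=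
  ⟨pair x.1 y.1, N.pair_mem_univ x y⟩

@[simp] theorem val_pr (x : N.Star α) (y : N.Star β) : (N.pr x y).1 = pair x.1 y.1 := rfl

theorem pr_inj {x x' : N.Star α} {y y' : N.Star β} :
    N.pr x y = N.pr x' y' ↔ x = x' ∧ y = y' := by
  rw [star_ext_iff, val_pr, val_pr, pair_eq_iff, star_ext_iff, star_ext_iff]

theorem exists_pr (p : N.Star (α × β)) : ∃ x y, p = N.pr x y := by
  have := (N.transfer_list (ball 3 2 (bex 4 0 (bex 5 1 (isPair 3 4 5)))) (code (Set.univ : Set α))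
    [code (Set.univ : Set α), code (Set.univ : Set β), code (Set.univ : Set (α × β))]).1
    (by simpa [valuation, ball_code, bex_code, holds_isPair, ← code_pair] using fun a b => ⟨a, b, rfl⟩)
  simp [valuation, holds_isPair] at this
  obtain ⟨x, hx, y, hy, h⟩ := this p.1 p.2
  exact ⟨⟨x, hx⟩, ⟨y, hy⟩, Subtype.ext h⟩

-- The quantifier is bounded by the code of the whole type `β`, so after transfer the witness ranges
-- over internal elements only.
@[simp] theorem T_exists {P : α → β → Prop} {x : N.Star α} :
    N.T (fun a => ∃ b, P a b) x ↔ ∃ y, N.T (fun p : α × β => P p.1 p.2) (N.pr x y) := by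
  have := (N.transfer_list (ball 4 0 (iff (mem 4 2) (bex 5 1 (pairMem 4 5 3))))
    (code (Set.univ : Set α)) [code (Set.univ : Set α), code (Set.univ : Set β),
      code {a | ∃ b, P a b}, code {p : α × β | P p.1 p.2}]).1
    (by simp [valuation, ball_code, bex_code, holds_pairMem, ← code_pair, code_mem_code])
  simp [valuation, holds_pairMem] at this
  rw [T, ext, this x.1 x.2]
  exact ⟨fun ⟨y, hy, h⟩ => ⟨⟨y, hy⟩, h⟩, fun ⟨y, h⟩ => ⟨y.1, y.2, h⟩⟩

@[simp] theorem T_forall {P : α → β → Prop} {x : N.Star α} :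
    N.T (fun a => ∀ b, P a b) x ↔ ∀ y, N.T (fun p : α × β => P p.1 p.2) (N.pr x y) := by
  have : (fun a => ∀ b, P a b) = fun a => ¬ ∃ b, ¬ P a b := by
    ext a
    simp
  rw [this, T_not, T_exists]
  simp only [T_not]
  push Not
  rfl

theorem T_fst {P : α → Prop} {x : N.Star α} {y : N.Star β} :
    N.T (fun p : α × β => P p.1) (N.pr x y) ↔ N.T P x := by
  have := (N.transfer_list (ball 4 0 (ball 5 1 (iff (mem 4 2) (pairMem 4 5 3))))
    (code (Set.univ : Set α)) [code (Set.univ : Set α), code (Set.univ : Set β),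
      code {a | P a}, code {p : α × β | P p.1}]).1
    (by simp [valuation, ball_code, holds_pairMem, ← code_pair, code_mem_code])
  simp [valuation, holds_pairMem] at this
  exact (this x.1 x.2 y.1 y.2).symm

theorem T_snd {P : β → Prop} {x : N.Star α} {y : N.Star β} :
    N.T (fun p : α × β => P p.2) (N.pr x y) ↔ N.T P y := by
  have := (N.transfer_list (ball 4 0 (ball 5 1 (iff (mem 5 2) (pairMem 4 5 3))))
    (code (Set.univ : Set α)) [code (Set.univ : Set α), code (Set.univ : Set β),
      code {a | P a}, code {p : α × β | P p.2}]).1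
    (by simp [valuation, ball_code, holds_pairMem, ← code_pair, code_mem_code])
  simp [valuation, holds_pairMem] at this
  exact (this x.1 x.2 y.1 y.2).symm

theorem T_eq_pr {x y : N.Star α} : N.T (fun p : α × α => p.1 = p.2) (N.pr x y) ↔ x = y := by
  have := (N.transfer_list (ball 4 0 (ball 5 0 (iff (eq 4 5) (pairMem 4 5 1))))
    (code (Set.univ : Set α)) [code (Set.univ : Set α), code {p : α × α | p.1 = p.2}]).1
    (by simp [valuation, ball_code, holds_pairMem, ← code_pair, code_mem_code,
      (Faithful.inj (α := α)).eq_iff])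
  simp [valuation, holds_pairMem] at this
  rw [star_ext_iff]
  exact (this x.1 x.2 y.1 y.2).symm

theorem T_mem_pr {x : N.Star α} {A : N.Star (Set α)} :
    N.T (fun p : α × Set α => p.1 ∈ p.2) (N.pr x A) ↔ x.1 ∈ A.1 := by
  have := (N.transfer_list (ball 4 0 (ball 5 1 (iff (mem 4 5) (pairMem 4 5 2))))
    (code (Set.univ : Set α)) [code (Set.univ : Set α), code (Set.univ : Set (Set α)),
      code {p : α × Set α | p.1 ∈ p.2}]).1
    (by simp [valuation, ball_code, holds_pairMem, ← code_pair, code_mem_code])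
  simp [valuation, holds_pairMem] at this
  exact (this x.1 x.2 A.1 A.2).symm

theorem mem_univ_of_mem {A : N.Star (Set α)} {x : Superstructure Y} (h : x ∈ A.1) :
    x ∈ N.ext (Set.univ : Set α) := by
  have := (N.transfer_list (ball 4 1 (ball 5 4 (mem 5 0)))
    (code (Set.univ : Set α)) [code (Set.univ : Set α), code (Set.univ : Set (Set α))]).1
    (by simp [valuation, ball_code, code_mem_code])
  simp [valuation] at this
  exact this A.1 A.2 x h

theorem exists_val_of_mem {A : N.Star (Set α)} {x : Superstructure Y} (h : x ∈ A.1) :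
    ∃ y : N.Star α, x = y.1 := ⟨⟨x, N.mem_univ_of_mem h⟩, rfl⟩

omit [Faithful α] in
-- Being a set is expressed as not belonging to `base ℝ`, which is a bounded formula; `star_base`
-- then says that `A` is not an atom of `V(Y)`.
theorem isSet_val (A : N.Star (Set α)) : IsSet A.1 := by
  have := (N.transfer_list (ball 4 1 (not (mem 4 0)))
    (base ℝ) [base ℝ, code (Set.univ : Set (Set α))]).1
    (by
      simp [valuation, ball_code]
      exact fun a => not_mem_base_of_isSet (isSet_mkSet _ _))
  simp [valuation, N.star_base] at this
  exact isSet_of_not_mem_base (this A.1 A.2)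

omit [Faithful α] in
theorem isInternal_val (x : N.Star α) : N.IsInternal x.1 := ⟨_, x.2⟩

/-- The defining property of the values of the nonstandard extension of a function. -/
theorem exists_lift (f : α → β) (x : N.Star α) :
    ∃ y : N.Star β, N.T (fun p : α × β => p.2 = f p.1) (N.pr x y) :=
  N.T_exists.1 (N.T_of_forall (P := fun a => ∃ b, b = f a) (fun _ => ⟨_, rfl⟩) x)

/-- The nonstandard extension of a function. -/
noncomputable def lift (f : α → β) (x : N.Star α) : N.Star β := (N.exists_lift f x).choose

theorem lift_spec (f : α → β) (x : N.Star α) :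
    N.T (fun p : α × β => p.2 = f p.1) (N.pr x (N.lift f x)) := (N.exists_lift f x).choose_spec

/-- `P (f a)` and `P b` agree along the graph of `f`. This is the change of variables that
rearranges nested tuples before a named predicate is recognised. -/
theorem T_comp {P : β → Prop} (f : α → β) {x : N.Star α} :
    N.T (fun a => P (f a)) x ↔ N.T P (N.lift f x) := by
  have h : N.T (fun p : α × β => p.2 = f p.1 → (P (f p.1) ↔ P p.2)) (N.pr x (N.lift f x)) :=
    N.T_of_forall (fun p hp => by rw [hp]) _
  rw [T_imp, T_iff] at h
  have := h (N.lift_spec f x)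
  rwa [N.T_fst (P := fun a => P (f a)), N.T_snd] at this

theorem lift_eq_of_T {f : α → β} {x : N.Star α} {y : N.Star β}
    (h : N.T (fun p : α × β => p.2 = f p.1) (N.pr x y)) : N.lift f x = y := by
  have := (N.transfer_list (ball 4 0 (ball 5 1 (ball 6 1 (imp (pairMem 4 5 2)
    (imp (pairMem 4 6 2) (eq 5 6)))))) (code (Set.univ : Set α)) [code (Set.univ : Set α),
      code (Set.univ : Set β), code {p : α × β | p.2 = f p.1}]).1
    (by simp [valuation, ball_code, holds_pairMem, ← code_pair, code_mem_code])
  simp [valuation, holds_pairMem] at this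
  exact Subtype.ext (this x.1 x.2 _ (N.lift f x).2 y.1 y.2 (N.lift_spec f x) h)

theorem lift_comp (f : α → β) (g : β → γ) (x : N.Star α) :
    N.lift (fun a => g (f a)) x = N.lift g (N.lift f x) := by
  have := (N.transfer_list (ball 6 0 (ball 7 1 (ball 8 2 (imp (pairMem 6 7 3)
    (imp (pairMem 7 8 4) (pairMem 6 8 5)))))) (code (Set.univ : Set α))
    [code (Set.univ : Set α), code (Set.univ : Set β), code (Set.univ : Set γ),
      code {p : α × β | p.2 = f p.1}, code {p : β × γ | p.2 = g p.1},
      code {p : α × γ | p.2 = g (f p.1)}]).1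
    (by simp [valuation, ball_code, holds_pairMem, ← code_pair, code_mem_code])
  simp [valuation, holds_pairMem] at this
  exact N.lift_eq_of_T (this x.1 x.2 _ (N.lift f x).2 _ (N.lift g (N.lift f x)).2
    (N.lift_spec f x) (N.lift_spec g _))

/-- The first component of an internal pair. -/
noncomputable def fst (p : N.Star (α × β)) : N.Star α := N.lift Prod.fst p

/-- The second component of an internal pair. -/
noncomputable def snd (p : N.Star (α × β)) : N.Star β := N.lift Prod.snd p

@[simp] theorem fst_pr (x : N.Star α) (y : N.Star β) : N.fst (N.pr x y) = x := by
  have := (N.transfer_list (ball 4 0 (ball 5 1 (ball 6 2 (imp (isPair 6 4 5) (pairMem 6 4 3)))))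
    (code (Set.univ : Set α)) [code (Set.univ : Set α), code (Set.univ : Set β),
      code (Set.univ : Set (α × β)), code {p : (α × β) × α | p.2 = p.1.1}]).1
    (by
      simp [valuation, ball_code, holds_pairMem, holds_isPair, ← code_pair, code_mem_code,
        Faithful.inj.eq_iff])
  simp [valuation, holds_pairMem, holds_isPair] at this
  exact N.lift_eq_of_T (this x.1 x.2 y.1 y.2 _ (N.pr x y).2 rfl)

@[simp] theorem snd_pr (x : N.Star α) (y : N.Star β) : N.snd (N.pr x y) = y := by
  have := (N.transfer_list (ball 4 0 (ball 5 1 (ball 6 2 (imp (isPair 6 4 5) (pairMem 6 5 3)))))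
    (code (Set.univ : Set α)) [code (Set.univ : Set α), code (Set.univ : Set β),
      code (Set.univ : Set (α × β)), code {p : (α × β) × β | p.2 = p.1.2}]).1
    (by
      simp [valuation, ball_code, holds_pairMem, holds_isPair, ← code_pair, code_mem_code,
        Faithful.inj.eq_iff])
  simp [valuation, holds_pairMem, holds_isPair] at this
  exact N.lift_eq_of_T (this x.1 x.2 y.1 y.2 _ (N.pr x y).2 rfl)

@[simp] theorem lift_fst (f : α → β × γ) (x : N.Star α) :
    N.lift (fun a => (f a).1) x = N.fst (N.lift f x) := N.lift_comp f Prod.fst x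

@[simp] theorem lift_snd (f : α → β × γ) (x : N.Star α) :
    N.lift (fun a => (f a).2) x = N.snd (N.lift f x) := N.lift_comp f Prod.snd x

@[simp] theorem lift_prod (f : α → β) (g : α → γ) (x : N.Star α) :
    N.lift (fun a => (f a, g a)) x = N.pr (N.lift f x) (N.lift g x) := by
  obtain ⟨u, v, h⟩ := N.exists_pr (N.lift (fun a => (f a, g a)) x)
  rw [h, N.pr_inj]
  constructor
  · rw [← N.fst_pr u v, ← h, ← lift_fst]
  · rw [← N.snd_pr u v, ← h, ← lift_snd]

@[simp] theorem lift_id (x : N.Star α) : N.lift (fun a => a) x = x := by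
  apply N.lift_eq_of_T
  have := (N.T_eq_pr (x := x)).2 rfl
  simpa only [eq_comm] using this

@[simp] theorem lift_const (b : β) (x : N.Star α) : N.lift (fun _ => b) x = N.std b := by
  apply N.lift_eq_of_T
  rw [N.T_snd (P := fun c => c = b), T_std]

@[simp] theorem T_eq (f g : α → β) (x : N.Star α) :
    N.T (fun a => f a = g a) x ↔ N.lift f x = N.lift g x := by
  rw [N.T_comp (P := fun p : β × β => p.1 = p.2) (fun a => (f a, g a)), lift_prod, T_eq_pr]

@[simp] theorem T_mem (f : α → β) (g : α → Set β) (x : N.Star α) :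
    N.T (fun a => f a ∈ g a) x ↔ (N.lift f x).1 ∈ (N.lift g x).1 := by
  rw [N.T_comp (P := fun p : β × Set β => p.1 ∈ p.2) (fun a => (f a, g a)), lift_prod, T_mem_pr]

/-- The internal definition principle. -/
theorem mem_lift_setOf {Q : α → β → Prop} {x : N.Star α} {z : N.Star β} :
    z.1 ∈ (N.lift (fun a => {b | Q a b}) x).1 ↔
      N.T (fun p : α × β => Q p.1 p.2) (N.pr x z) := by
  have := N.T_mem (fun p : α × β => p.2) (fun p => {b | Q p.1 b}) (N.pr x z)
  rw [N.lift_comp Prod.fst (fun a => {b | Q a b}), lift_snd, lift_id, snd_pr] at this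
  rw [← fst, fst_pr] at this
  exact this.symm

theorem val_std (a : α) : (N.std a).1 = N.ext a := rfl

/-- Single-valuedness of `R` transfers, so the choice made in `app` is forced. This connects the
definitions phrased with `app` to the internal calculus. -/
theorem app_std {R : Set (α × β)} (hR : ∀ a b b', (a, b) ∈ R → (a, b') ∈ R → b = b')
    {x : N.Star α} {y : N.Star β} (h : pair x.1 y.1 ∈ N.ext R) : app (N.ext R) x.1 = y.1 := by
  refine app_eq_of_unique h fun z hz => ?_
  -- `z` is an arbitrary element of `V(Y)`; it is internal because it is a component of an element
  -- of `N.ext R`.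
  obtain ⟨x', z', h'⟩ := N.exists_pr ⟨pair x.1 z, N.mem_ext_univ hz⟩
  obtain ⟨-, rfl⟩ := pair_eq_iff.1 (Subtype.ext_iff.1 h')
  have := N.T_of_forall
    (P := fun p : α × β × β => (p.1, p.2.1) ∈ R → (p.1, p.2.2) ∈ R → p.2.1 = p.2.2)
    (fun p => hR _ _ _) (N.pr x (N.pr z' y))
  simp [val_std] at this
  exact Subtype.ext_iff.1 (this hz h)

end

end NonstandardExtension

/-! ## Delta-bases of finite-dimensional spaces of continuous functions -/

/-- For a definite bilinear form on a finite-dimensional space, and a separating family of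
functionals, those functionals which are represented by a family of vectors containing a given
independent subfamily extend to a basis of representing vectors. -/
theorem exists_basis_of_representing {D W : Type*} [AddCommGroup W] [Module ℝ W]
    [FiniteDimensional ℝ W] (B : W →ₗ[ℝ] W →ₗ[ℝ] ℝ) (hB : ∀ f, B f f = 0 → f = 0)
    (ev : D → W →ₗ[ℝ] ℝ) (hev : ∀ f, (∀ a, ev a f = 0) → f = 0) (F : Set D)
    (hF : ∀ a ∈ F, ∃ f, ev a f ≠ 0 ∧ ∀ x ∈ F, x ≠ a → ev x f = 0) :
    ∃ (S : Set D) (e : D → W), F ⊆ S ∧ (∀ a f, B f (e a) = ev a f) ∧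
      LinearIndepOn ℝ e S ∧ Submodule.span ℝ (e '' S) = ⊤ := by
  -- Definiteness makes `f ↦ C f` injective, hence onto the dual, which has the same dimension. It
  -- is used for `B.flip` to represent the evaluations, and for `B` to represent a functional
  -- killing the span.
  have hsurj : ∀ C : W →ₗ[ℝ] W →ₗ[ℝ] ℝ, (∀ f, C f f = 0 → f = 0) → Function.Surjective C := by
    intro C hC
    refine (LinearMap.injective_iff_surjective_of_finrank_eq_finrank
      (Subspace.dual_finrank_eq (K := ℝ) (V := W)).symm).1 ?_
    rw [injective_iff_map_eq_zero]
    intro f hf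
    exact hC f (by simp [hf])
  choose e he using fun a => hsurj B.flip (fun f => hB f) (ev a)
  have he' : ∀ a f, B f (e a) = ev a f := fun a f => by
    rw [← he a]
    rfl
  have hind : LinearIndepOn ℝ e F := by
    rw [linearIndepOn_iff']
    intro t c htF hsum a ha
    obtain ⟨f, hfa, hf⟩ := hF a (htF ha)
    have h := congrArg (B f) hsum
    rw [map_sum, map_zero, Finset.sum_eq_single a] at h
    · rw [map_smul, he', smul_eq_mul] at h
      exact (mul_eq_zero.1 h).resolve_right hfa
    · intro x hx hxa
      rw [map_smul, he', hf x (htF hx) hxa, smul_zero]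
    · exact fun h => absurd ha h
  -- `S` is chosen so that every `e a` lies in the span of `e '' S`.
  obtain ⟨S, -, hFS, hspan, hS⟩ := exists_linearIndepOn_extension hind (Set.subset_univ F)
  refine ⟨S, e, hFS, he', hS, ?_⟩
  by_contra hne
  obtain ⟨φ, hφ, hle⟩ := Submodule.exists_le_ker_of_lt_top _ (lt_top_iff_ne_top.2 hne)
  obtain ⟨f, rfl⟩ := hsurj B hB φ
  refine hφ ?_
  rw [hev f, map_zero]
  intro a
  rw [← he']
  exact hle (hspan ⟨a, trivial, rfl⟩)

section

open MeasureTheory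

theorem exists_deltaBasis_of_continuous {b : ℝ} (hb : 0 < b)
    (W : Submodule ℝ (Set.Icc (-b) b → ℝ)) [FiniteDimensional ℝ W]
    (hW : ∀ w ∈ W, Continuous w) (F : Set (Set.Icc (-b) b))
    (hF : ∀ a ∈ F, ∃ w ∈ W, w a ≠ 0 ∧ ∀ x ∈ F, x ≠ a → w x = 0) :
    ∃ (S : Set (Set.Icc (-b) b)) (e : Set.Icc (-b) b → Set.Icc (-b) b → ℝ), F ⊆ S ∧
      (∀ a, e a ∈ W) ∧ LinearIndepOn ℝ e S ∧ Submodule.span ℝ (e '' S) = W ∧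
      ∀ a, ∀ w ∈ W, ∃ u v : ℝ → ℝ, (∀ x : Set.Icc (-b) b, u x = w x) ∧
        (∀ x : Set.Icc (-b) b, v x = e a x) ∧
        IntegrableOn (fun x => u x * v x) (Set.Icc (-b) b) ∧
        ∫ x in Set.Icc (-b) b, u x * v x = w a := by
  have hbb : -b ≤ b := by linarith
  -- Constant continuation beyond the endpoints, so that the integrals are over a subset of `ℝ` and
  -- the integrands stay continuous.
  let E := fun w : Set.Icc (-b) b → ℝ => Set.IccExtend hbb w
  have hE : ∀ w ∈ W, Continuous (E w) := fun w hw => (hW w hw).Icc_extend'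
  have hEx : ∀ w, ∀ x : Set.Icc (-b) b, E w x = w x := fun w x => Set.IccExtend_val hbb w x
  have hint : ∀ w ∈ W, ∀ w' ∈ W, IntegrableOn (fun x => E w x * E w' x) (Set.Icc (-b) b) :=
    fun w hw w' hw' => ((hE w hw).mul (hE w' hw')).integrableOn_Icc
  let B : W →ₗ[ℝ] W →ₗ[ℝ] ℝ := LinearMap.mk₂ ℝ
    (fun f g => ∫ x in Set.Icc (-b) b, E f.1 x * E g.1 x)
    (by
      intro f f' g
      rw [← integral_add (hint _ f.2 _ g.2) (hint _ f'.2 _ g.2)]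
      refine integral_congr_ae (.of_forall fun x => ?_)
      exact add_mul _ _ _)
    (by
      intro c f g
      rw [smul_eq_mul, ← integral_const_mul]
      refine integral_congr_ae (.of_forall fun x => ?_)
      exact mul_assoc _ _ _)
    (by
      intro f g g'
      rw [← integral_add (hint _ f.2 _ g.2) (hint _ f.2 _ g'.2)]
      refine integral_congr_ae (.of_forall fun x => ?_)
      exact mul_add _ _ _)
    (by
      intro c f g
      rw [smul_eq_mul, ← integral_const_mul]
      refine integral_congr_ae (.of_forall fun x => ?_)
      exact mul_left_comm _ _ _)
  have hB : ∀ f, B f f = 0 → f = 0 := by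
    intro f hf
    -- A square with zero integral vanishes almost everywhere, hence everywhere by continuity, since
    -- the interval is nondegenerate.
    have h0 := (integral_eq_zero_iff_of_nonneg (fun x => mul_self_nonneg (E f.1 x))
      (hint _ f.2 _ f.2)).1 hf
    have h1 := Measure.eqOn_Icc_of_ae_eq volume (by linarith : -b ≠ b) h0
      ((hE _ f.2).mul (hE _ f.2)).continuousOn continuousOn_const
    ext x
    have := h1 x.2
    simpa [hEx] using this
  let ev : Set.Icc (-b) b → W →ₗ[ℝ] ℝ := fun a => (LinearMap.proj a).comp W.subtype
  obtain ⟨S, e, hFS, he, hind, hspan⟩ := exists_basis_of_representing B hB ev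
    (fun f hf => Subtype.ext (funext hf)) F (by
      intro a ha
      obtain ⟨w, hw, h⟩ := hF a ha
      exact ⟨⟨w, hw⟩, h⟩)
  refine ⟨S, fun a => (e a).1, hFS, fun a => (e a).2, ?_, ?_, ?_⟩
  · exact LinearIndependent.map' hind W.subtype (Submodule.ker_subtype W)
  · have := congrArg (Submodule.map W.subtype) hspan
    rwa [Submodule.map_span, Submodule.map_top, Submodule.range_subtype, Set.image_image] at this
  · intro a w hw
    exact ⟨E w, E (e a).1, hEx w, hEx _, hint w hw _ (e a).2, he a ⟨w, hw⟩⟩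

end

/-! ## Ultrafunctions, before the nonstandard extension -/

/-- The span of the functions of class `C¹` in `L`. -/
def c1Span (L : Set (Set (ℝ × ℝ))) : Set (Set (ℝ × ℝ)) :=
  realGraph '' (Submodule.span ℝ {f : ℝ → ℝ | ContDiff ℝ 1 f ∧ realGraph f ∈ L} : Set (ℝ → ℝ))

/-- The part of a graph over `[-b, b]`. -/
def restrGraph (b : ℝ) (u : Set (ℝ × ℝ)) : Set (ℝ × ℝ) :=
  {q | q ∈ u ∧ -b ≤ q.1 ∧ q.1 ≤ b}

/-- The space of the restrictions to `[-b, b]` of the functions in `c1Span L`. -/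
def restrSpace (L : Set (Set (ℝ × ℝ))) (b : ℝ) : Set (Set (ℝ × ℝ)) :=
  {w | ∃ u, u ∈ c1Span L ∧ w = restrGraph b u}

/-- `d` is a Delta function centered in `q`. -/
def StdDelta (L : Set (Set (ℝ × ℝ))) (b q : ℝ) (d : Set (ℝ × ℝ)) : Prop :=
  d ∈ restrSpace L b ∧ ∀ v, v ∈ restrSpace L b →
    ∃ r : ℝ, (q, r) ∈ v ∧ ((b, (v, d)), r) ∈ innerFunction

/-- `d` is a Delta-basis. -/
def StdDeltaBasis (L : Set (Set (ℝ × ℝ))) (b : ℝ) (d : Set (ℝ × Set (ℝ × ℝ))) : Prop :=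
  (d, restrSpace L b) ∈ basisRelation ∧
    ∀ (a : ℝ) (e : Set (ℝ × ℝ)), (a, e) ∈ d → (-b ≤ a ∧ a ≤ b) ∧ StdDelta L b a e

theorem realGraph_injective : Function.Injective realGraph := fun f g h => by
  ext x
  have : (x, f x) ∈ realGraph g := h ▸ rfl
  exact this

theorem restrGraph_realGraph (b : ℝ) (f : ℝ → ℝ) :
    restrGraph b (realGraph f) = graphOn (fun x : Set.Icc (-b) b => f x) := by
  ext ⟨x, y⟩
  simp only [restrGraph, realGraph, graphOn, Set.mem_ofPred_eq, Prod.mk.injEq, Subtype.exists,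
    Set.mem_Icc]
  constructor
  · rintro ⟨rfl, h⟩
    exact ⟨x, h, rfl, rfl⟩
  · rintro ⟨_, h, rfl, rfl⟩
    exact ⟨rfl, h⟩

/-- The form that is transferred: functions are coded by graphs, and separation on `F` is a
hypothesis. Finiteness of `L` gives finite dimension. -/
theorem exists_stdDeltaBasis {L : Set (Set (ℝ × ℝ))} (hL : L.Finite) {b : ℝ} (hb : 0 < b)
    {F : Set ℝ} (hFb : ∀ a ∈ F, -b ≤ a ∧ a ≤ b)
    (hF : ∀ a ∈ F, ∃ u ∈ c1Span L, (∃ y, y ≠ 0 ∧ (a, y) ∈ u) ∧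
      ∀ x ∈ F, x ≠ a → (x, (0 : ℝ)) ∈ u) :
    ∃ d, StdDeltaBasis L b d ∧ ∀ a ∈ F, ∃ e, (a, e) ∈ d := by
  set M : Submodule ℝ (ℝ → ℝ) :=
    Submodule.span ℝ {f : ℝ → ℝ | ContDiff ℝ 1 f ∧ realGraph f ∈ L} with hM
  have hfin : {f : ℝ → ℝ | ContDiff ℝ 1 f ∧ realGraph f ∈ L}.Finite :=
    (hL.preimage realGraph_injective.injOn).subset fun f hf => hf.2
  have : FiniteDimensional ℝ M := FiniteDimensional.span_of_finite ℝ hfin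
  let R : (ℝ → ℝ) →ₗ[ℝ] (Set.Icc (-b) b → ℝ) := LinearMap.funLeft ℝ ℝ Subtype.val
  have hcont : ∀ f ∈ M, Continuous f := by
    intro f hf
    induction hf using Submodule.span_induction with
    | mem f hf => exact hf.1.continuous
    | zero => exact continuous_const
    | add f g _ _ hf hg => exact hf.add hg
    | smul c f _ hf => exact hf.const_smul c
  have hspace : restrSpace L b = graphOn '' (M.map R : Set (Set.Icc (-b) b → ℝ)) := by
    ext w
    constructor
    · rintro ⟨_, ⟨f, hf, rfl⟩, rfl⟩
      exact ⟨R f, ⟨f, hf, rfl⟩, (restrGraph_realGraph b f).symm⟩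
    · rintro ⟨_, ⟨f, hf, rfl⟩, rfl⟩
      exact ⟨_, ⟨f, hf, rfl⟩, (restrGraph_realGraph b f).symm⟩
  obtain ⟨S, e, hFS, heW, hind, hspan, hdelta⟩ := exists_deltaBasis_of_continuous hb (M.map R)
    (by
      rintro _ ⟨f, hf, rfl⟩
      exact (hcont f hf).comp continuous_subtype_val)
    (Subtype.val ⁻¹' F) (by
      rintro ⟨a, hab⟩ ha
      obtain ⟨_, ⟨f, hf, rfl⟩, ⟨y, hy, hay⟩, h0⟩ := hF a ha
      refine ⟨R f, ⟨f, hf, rfl⟩, ?_, ?_⟩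
      · change f a ≠ 0
        rwa [← show y = f a from hay]
      · intro x hx hxa
        exact (h0 x hx (fun h => hxa (Subtype.ext h))).symm)
  refine ⟨{q | ∃ a : S, q = ((a : ℝ), graphOn (e a))}, ⟨?_, ?_⟩, ?_⟩
  · let φ := (Equiv.Set.image (Subtype.val : Set.Icc (-b) b → ℝ) S Subtype.val_injective).symm
    refine ⟨Set.Icc (-b) b, Subtype.val '' S, fun a => e (φ a), M.map R,
      LinearIndependent.comp hind φ φ.injective, ?_, ?_⟩
    · rw [← hspan]
      congr 1
      ext w
      constructor
      · rintro ⟨a, rfl⟩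
        exact ⟨_, (φ a).2, rfl⟩
      · rintro ⟨s, hs, rfl⟩
        obtain ⟨a, ha⟩ := φ.surjective ⟨s, hs⟩
        exact ⟨a, by simp [ha]⟩
    · rw [hspace, Prod.mk.injEq]
      refine ⟨?_, rfl⟩
      ext q
      constructor
      · rintro ⟨a, rfl⟩
        exact ⟨φ.symm a, by simp [φ]⟩
      · rintro ⟨a, rfl⟩
        obtain ⟨a, rfl⟩ := φ.symm.surjective a
        exact ⟨a, by simp [φ]⟩
  · rintro a g ⟨s, hs⟩
    obtain ⟨rfl, rfl⟩ := Prod.mk.inj hs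
    refine ⟨s.1.2, ?_, ?_⟩
    · rw [hspace]
      exact ⟨_, heW _, rfl⟩
    · rw [hspace]
      rintro _ ⟨w, hw, rfl⟩
      obtain ⟨u, v, hu, hv, huv, hI⟩ := hdelta s.1 w hw
      refine ⟨w s.1, ⟨s.1, rfl⟩, b, u, v, hb, huv, ?_⟩
      simp only [hu, hv, hI]
  · intro a ha
    exact ⟨_, ⟨⟨⟨a, hFb a ha⟩, hFS ha⟩, rfl⟩⟩

/-! ## Ultrafunctions in terms of transferred predicates -/

namespace NonstandardExtension

variable {Y : Type u} (N : NonstandardExtension Y)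

/-! ### Order and negation of hyperreal numbers -/

section

variable {α : Type} [RealCode α] [Faithful α]

@[simp] theorem T_le (f g : α → ℝ) (x : N.Star α) :
    N.T (fun a => f a ≤ g a) x ↔ N.HLe (N.lift f x).1 (N.lift g x).1 := by
  rw [N.T_comp (P := fun p : ℝ × ℝ => p.1 ≤ p.2) (fun a => (f a, g a)), lift_prod]
  rfl

@[simp] theorem T_lt (f g : α → ℝ) (x : N.Star α) :
    N.T (fun a => f a < g a) x ↔ N.HLt (N.lift f x).1 (N.lift g x).1 := by
  rw [N.T_comp (P := fun p : ℝ × ℝ => p.1 < p.2) (fun a => (f a, g a)), lift_prod]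
  rfl

/-- The negative of a hyperreal number. -/
noncomputable def neg (x : N.Star ℝ) : N.Star ℝ := N.lift (fun r => -r) x

@[simp] theorem lift_neg (f : α → ℝ) (x : N.Star α) :
    N.lift (fun a => -f a) x = N.neg (N.lift f x) := N.lift_comp f (fun r => -r) x

theorem hneg_val (x : N.Star ℝ) : N.hneg x.1 = (N.neg x).1 := by
  refine N.app_std (fun a b b' h h' => ?_) (N.lift_spec (fun r => -r) x)
  exact Eq.trans (b := -a) h (Eq.symm h')

theorem lift_std {β : Type} [RealCode β] [Faithful β] (f : α → β) (a : α) :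
    N.lift f (N.std a) = N.std (f a) := by
  rw [← N.lift_const a (N.std a), ← lift_comp, lift_const]

theorem std_injective : Function.Injective (N.std (α := α)) := fun a b h => by
  have : N.T (fun c => c = a) (N.std b) := h ▸ N.T_std.2 rfl
  exact (N.T_std.1 this).symm

theorem mem_univ_real {x : Superstructure Y} (h : x ∈ base Y) :
    x ∈ N.ext (Set.univ : Set ℝ) := by
  rw [← N.star_base] at h
  refine N.star_subset (fun z hz => ?_) h
  obtain ⟨r, rfl⟩ := mem_base.1 hz
  exact mem_code_set.2 ⟨r, trivial, rfl⟩

theorem val_mem_base (x : N.Star ℝ) : x.1 ∈ base Y := by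
  rw [← N.star_base]
  refine N.star_subset (fun z hz => ?_) x.2
  obtain ⟨r, -, rfl⟩ := mem_code_set.1 hz
  exact mem_base.2 ⟨r, rfl⟩

theorem mem_interval {b x : N.Star ℝ} :
    x.1 ∈ N.interval b.1 ↔ N.HLe (N.neg b).1 x.1 ∧ N.HLe x.1 b.1 := by
  rw [← hneg_val]
  exact and_iff_right (N.val_mem_base x)

end

/-- The externally separated set `C¹(ℝ)* ∩ Λ` has the same elements as an internal one, on which
`spanFunction` can be evaluated; that relation is single-valued because a function is determined by
its graph. -/
theorem c1Tilde_val (L : N.Star (Set (Set (ℝ × ℝ)))) :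
    N.c1Tilde L.1 = (N.lift c1Span L).1 := by
  have hsep : sep (N.ext c1Functions) {u | u ∈ L.1} =
      (N.lift (fun A : Set (Set (ℝ × ℝ)) => {u | u ∈ c1Functions ∧ u ∈ A}) L).1 := by
    refine isSet_ext (isSet_mkSet _ _) (N.isSet_val _) fun z => ?_
    have key : ∀ z : N.Star (Set (ℝ × ℝ)), z.1 ∈ (N.lift (fun A : Set (Set (ℝ × ℝ)) =>
        {u | u ∈ c1Functions ∧ u ∈ A}) L).1 ↔ z.1 ∈ N.ext c1Functions ∧ z.1 ∈ L.1 := fun z => by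
      rw [N.mem_lift_setOf (Q := fun A u => u ∈ c1Functions ∧ u ∈ A)]
      simp [val_std]
    refine mem_sep.trans ⟨fun h => ?_, fun h => ?_⟩
    · obtain ⟨z, rfl⟩ := N.exists_val_of_mem h.2
      exact (key z).2 h
    · obtain ⟨z, rfl⟩ := N.exists_val_of_mem h
      exact (key z).1 h
  rw [c1Tilde, hsep]
  refine N.app_std ?_ ?_
  · rintro _ _ _ ⟨A, hA⟩ ⟨B, hB⟩
    obtain ⟨rfl, rfl⟩ := Prod.mk.inj hA
    obtain ⟨hAB, rfl⟩ := Prod.mk.inj hB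
    rw [realGraph_injective.image_injective hAB]
  · have := N.T_of_forall
      (P := fun A => ({u | u ∈ c1Functions ∧ u ∈ A}, c1Span A) ∈ spanFunction) (fun A => by
        refine ⟨{f : ℝ → ℝ | ContDiff ℝ 1 f ∧ realGraph f ∈ A}, ?_⟩
        rw [c1Span, Prod.mk.injEq]
        refine ⟨?_, rfl⟩
        ext u
        constructor
        · rintro ⟨⟨f, hf, rfl⟩, h⟩
          exact ⟨f, ⟨hf, h⟩, rfl⟩
        · rintro ⟨f, ⟨hf, h⟩, rfl⟩
          exact ⟨⟨f, hf, rfl⟩, h⟩) L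
    simpa [val_std] using this

/-- The restriction to `[-b, b]` of an internal graph. -/
noncomputable def restrict (b : N.Star ℝ) (u : N.Star (Set (ℝ × ℝ))) : N.Star (Set (ℝ × ℝ)) :=
  N.lift (fun p => {q | q ∈ p.2 ∧ -p.1 ≤ q.1 ∧ q.1 ≤ p.1}) (N.pr b u)

theorem restr_val (b : N.Star ℝ) (u : N.Star (Set (ℝ × ℝ))) :
    restr u.1 (N.interval b.1) = (N.restrict b u).1 := by
  refine isSet_ext (isSet_mkSet _ _) (N.isSet_val _) fun z => ?_
  have key : ∀ w : N.Star (ℝ × ℝ), w.1 ∈ (N.restrict b u).1 ↔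
      w.1 ∈ u.1 ∧ (N.fst w).1 ∈ N.interval b.1 := fun w => by
    rw [restrict, mem_lift_setOf, mem_interval]
    simp
  refine mem_restr.trans ⟨?_, fun hz => ?_⟩
  · rintro ⟨hz, x, hx, y, rfl⟩
    obtain ⟨x', y', h⟩ := N.exists_pr ⟨pair x y, N.mem_univ_of_mem hz⟩
    obtain ⟨rfl, rfl⟩ := pair_eq_iff.1 (N.star_ext_iff.1 h)
    have := (key (N.pr x' y')).2
    rw [fst_pr] at this
    exact this ⟨hz, hx⟩
  · obtain ⟨x', y', h⟩ := N.exists_pr ⟨z, N.mem_univ_of_mem hz⟩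
    obtain rfl : z = pair x'.1 y'.1 := N.star_ext_iff.1 h
    have := (key (N.pr x' y')).1 hz
    rw [fst_pr] at this
    exact ⟨this.1, _, this.2, _, rfl⟩

/-- The space of ultrafunctions, as an internal element. -/
noncomputable def space (L : N.Star (Set (Set (ℝ × ℝ)))) (b : N.Star ℝ) :
    N.Star (Set (Set (ℝ × ℝ))) :=
  N.lift (fun p => restrSpace p.1 p.2) (N.pr L b)

@[simp] theorem lift_restrSpace {α : Type} [RealCode α] [Faithful α]
    (f : α → Set (Set (ℝ × ℝ))) (g : α → ℝ) (x : N.Star α) :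
    N.lift (fun a => restrSpace (f a) (g a)) x = N.space (N.lift f x) (N.lift g x) := by
  rw [N.lift_comp (fun a => (f a, g a)) (fun p => restrSpace p.1 p.2), lift_prod, space]

@[simp] theorem lift_restrGraph {α : Type} [RealCode α] [Faithful α]
    (f : α → ℝ) (g : α → Set (ℝ × ℝ)) (x : N.Star α) :
    N.lift (fun a => restrGraph (f a) (g a)) x = N.restrict (N.lift f x) (N.lift g x) := by
  rw [N.lift_comp (fun a => (f a, g a)) (fun p => restrGraph p.1 p.2), lift_prod, restrict]
  rfl

@[simp] theorem lift_c1Span {α : Type} [RealCode α] [Faithful α]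
    (f : α → Set (Set (ℝ × ℝ))) (x : N.Star α) :
    N.lift (fun a => c1Span (f a)) x = N.lift c1Span (N.lift f x) := N.lift_comp f c1Span x

theorem ultrafunctions_val (L : N.Star (Set (Set (ℝ × ℝ)))) (b : N.Star ℝ) :
    N.ultrafunctions L.1 b.1 = (N.space L b).1 := by
  refine isSet_ext (isSet_mkSet _ _) (N.isSet_val _) fun z => ?_
  have key : ∀ w : N.Star (Set (ℝ × ℝ)), w.1 ∈ (N.space L b).1 ↔
      ∃ u : N.Star (Set (ℝ × ℝ)), u.1 ∈ (N.lift c1Span L).1 ∧ w = N.restrict b u := fun w => by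
    have := N.mem_lift_setOf
      (Q := fun (p : Set (Set (ℝ × ℝ)) × ℝ) w => ∃ u, u ∈ c1Span p.1 ∧ w = restrGraph p.2 u)
      (x := N.pr L b) (z := w)
    refine this.trans ?_
    simp
  refine mem_restrAll.trans ⟨?_, fun hz => ?_⟩
  · rintro ⟨u, hu, rfl⟩
    rw [c1Tilde_val] at hu
    rw [N.restr_val b ⟨u, N.mem_univ_of_mem hu⟩]
    exact (key _).2 ⟨_, hu, rfl⟩
  · obtain ⟨u, hu, h⟩ := (key ⟨z, N.mem_univ_of_mem hz⟩).1 hz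
    refine ⟨u.1, ?_, ?_⟩
    · rwa [c1Tilde_val]
    · rw [restr_val, ← h]

theorem isDelta_of_T {L : N.Star (Set (Set (ℝ × ℝ)))} {b q : N.Star ℝ}
    {d : N.Star (Set (ℝ × ℝ))}
    (h : N.T (fun p : (Set (Set (ℝ × ℝ)) × ℝ) × ℝ × Set (ℝ × ℝ) =>
      StdDelta p.1.1 p.1.2 p.2.1 p.2.2) (N.pr (N.pr L b) (N.pr q d))) :
    N.IsDelta L.1 b.1 q.1 d.1 := by
  simp [StdDelta] at h
  rw [IsDelta, ultrafunctions_val]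
  refine ⟨h.1, fun v hv => ?_⟩
  obtain ⟨v, rfl⟩ := N.exists_val_of_mem hv
  obtain ⟨r, hr⟩ := h.2 v hv
  exact ⟨r.1, hr⟩

theorem isDeltaBasis_of_T {L : N.Star (Set (Set (ℝ × ℝ)))} {b : N.Star ℝ}
    {d : N.Star (Set (ℝ × Set (ℝ × ℝ)))}
    (h : N.T (fun p : (Set (Set (ℝ × ℝ)) × ℝ) × Set (ℝ × Set (ℝ × ℝ)) =>
      StdDeltaBasis p.1.1 p.1.2 p.2) (N.pr (N.pr L b) d)) :
    N.IsDeltaBasis L.1 b.1 (N.lift (fun d => {a | ∃ e, (a, e) ∈ d}) d).1 d.1 := by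
  have hdom : ∀ a : N.Star ℝ, a.1 ∈ (N.lift (fun d => {a | ∃ e, (a, e) ∈ d}) d).1 ↔
      ∃ e : N.Star (Set (ℝ × ℝ)), pair a.1 e.1 ∈ d.1 := fun a => by
    rw [N.mem_lift_setOf (Q := fun (d : Set (ℝ × Set (ℝ × ℝ))) a => ∃ e, (a, e) ∈ d)]
    simp
  have hpair : ∀ a e, pair a e ∈ d.1 → ∃ (a' : N.Star ℝ) (e' : N.Star (Set (ℝ × ℝ))),
      a = a'.1 ∧ e = e'.1 := fun a e hae => by
    obtain ⟨a', e', h'⟩ := N.exists_pr ⟨pair a e, N.mem_univ_of_mem hae⟩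
    exact ⟨a', e', pair_eq_iff.1 (N.star_ext_iff.1 h')⟩
  simp only [StdDeltaBasis, T_and, T_forall, T_imp] at h
  obtain ⟨h1, h2⟩ := h
  have h2' : ∀ a e, pair a e ∈ d.1 → a ∈ N.interval b.1 ∧ N.IsDelta L.1 b.1 a e := by
    intro a e hae
    obtain ⟨a, e, rfl, rfl⟩ := hpair a e hae
    obtain ⟨h3, h4⟩ := h2 a e (by simpa using hae)
    rw [N.T_comp (P := fun p : (Set (Set (ℝ × ℝ)) × ℝ) × ℝ × Set (ℝ × ℝ) =>
      StdDelta p.1.1 p.1.2 p.2.1 p.2.2) (fun p : (((Set (Set (ℝ × ℝ)) × ℝ) ×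
      Set (ℝ × Set (ℝ × ℝ))) × ℝ) × Set (ℝ × ℝ) => (p.1.1.1, (p.1.2, p.2)))] at h4
    refine ⟨?_, N.isDelta_of_T (by simpa using h4)⟩
    rw [mem_interval]
    simpa using h3
  have hdom' : ∀ a, a ∈ (N.lift (fun d => {a | ∃ e, (a, e) ∈ d}) d).1 ↔ ∃ e, pair a e ∈ d.1 := by
    intro a
    constructor
    · intro ha
      obtain ⟨e, he⟩ := (hdom ⟨a, N.mem_univ_of_mem ha⟩).1 ha
      exact ⟨_, he⟩
    · rintro ⟨e, he⟩
      obtain ⟨a, e, rfl, rfl⟩ := hpair a e he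
      exact (hdom a).2 ⟨e, he⟩
  refine ⟨N.isSet_val _, ?_, hdom', ?_, fun a e hae => (h2' a e hae).2⟩
  · intro a ha
    obtain ⟨e, he⟩ := (hdom' a).1 ha
    exact (h2' a e he).1
  · rw [ultrafunctions_val]
    simpa [val_std] using h1

end NonstandardExtension

/-! ## Separation of standard and extreme points -/

namespace NonstandardExtension

variable {Y : Type u} (N : NonstandardExtension Y)

theorem std_lt_of_isPosInfinite {b : N.Star ℝ} (hb : N.IsPosInfinite b.1) (M : ℝ) :
    N.HLt (N.std M).1 b.1 := by
  obtain ⟨n, hn⟩ := exists_nat_ge M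
  have := N.T_of_forall (P := fun x : ℝ => (n : ℝ) < x → M < x) (fun x => hn.trans_lt) b
  rw [T_imp, T_lt, T_lt, lift_const, lift_const, lift_id] at this
  exact this (hb.2 n)

theorem T_of_eventually {b : N.Star ℝ} (hb : N.IsPosInfinite b.1) {P : ℝ → Prop} (M : ℝ)
    (h : ∀ x, M < x → P x) : N.T P b := by
  have := N.T_of_forall (P := fun x : ℝ => M < x → P x) h b
  rw [T_imp, T_lt, lift_const, lift_id] at this
  exact this (N.std_lt_of_isPosInfinite hb M)

/-- The standard and the two extreme points of `[-b, b]`. -/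
def basicPoints (b : N.Star ℝ) : Set (N.Star ℝ) := Set.range N.std ∪ {b, N.neg b}

/-- A standard `f` suffices: its values at `b` and `-b` are governed by its behaviour near `+∞` and
`-∞`, and only finitely many standard points are left to avoid. -/
theorem exists_separating {b : N.Star ℝ} (hb : N.IsPosInfinite b.1) {J : Set (N.Star ℝ)}
    (hJ : J.Finite) (hJb : J ⊆ N.basicPoints b) {a : N.Star ℝ} (ha : a ∈ N.basicPoints b) :
    ∃ f : ℝ → ℝ, ContDiff ℝ 1 f ∧ N.lift f a ≠ N.std 0 ∧
      ∀ x ∈ J, x ≠ a → N.lift f x = N.std 0 := by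
  have hfin : (N.std ⁻¹' J).Finite := hJ.preimage N.std_injective.injOn
  have hb0 : ∀ (f : ℝ → ℝ) (M : ℝ), (∀ x, M < x → f x = 0) → N.lift f b = N.std 0 := by
    intro f M h
    simpa using N.T_of_eventually hb M h
  have hneg : ∀ (f : ℝ → ℝ), N.lift f (N.neg b) = N.lift (fun x => f (-x)) b := fun f =>
    (N.lift_comp (fun x => -x) f b).symm
  have hcases : ∀ f : ℝ → ℝ, (∀ r, N.std r ∈ J → N.std r ≠ a → f r = 0) →
      (b ≠ a → N.lift f b = N.std 0) → (N.neg b ≠ a → N.lift f (N.neg b) = N.std 0) →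
      ∀ x ∈ J, x ≠ a → N.lift f x = N.std 0 := by
    intro f h1 h2 h3 x hx hxa
    rcases hJb hx with ⟨r, rfl⟩ | rfl | rfl
    · rw [lift_std, h1 r hx hxa]
    · exact h2 hxa
    · exact h3 hxa
  rcases ha with ⟨r, rfl⟩ | rfl | rfl
  · have hcl : IsClosed (N.std ⁻¹' J \ {r}) := (hfin.subset Set.sdiff_subset).isClosed
    obtain ⟨ε, hε, hball⟩ := Metric.isOpen_iff.1 hcl.isOpen_compl r (by simp)
    let g : ContDiffBump r := ⟨ε / 2, ε, half_pos hε, half_lt_self hε⟩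
    have hg : ∀ x, ε ≤ dist x r → g x = 0 := fun x hx => g.zero_of_le_dist hx
    refine ⟨g, g.contDiff, ?_, hcases _ ?_ ?_ ?_⟩
    · rw [lift_std, N.std_injective.ne_iff]
      rw [g.one_of_mem_closedBall (Metric.mem_closedBall_self g.rIn_pos.le)]
      exact one_ne_zero
    · intro s hs hsr
      apply hg
      by_contra! hlt
      exact hball hlt ⟨hs, fun h => hsr (by rw [Set.mem_singleton_iff.1 h])⟩
    · intro _
      refine hb0 _ (r + ε) fun x hx => hg x ?_
      rw [Real.dist_eq]
      exact (by linarith : ε ≤ x - r).trans (le_abs_self _)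
    · intro _
      rw [hneg]
      refine hb0 _ (ε - r) fun x hx => hg _ ?_
      rw [Real.dist_eq]
      exact (by linarith : ε ≤ -(-x - r)).trans (neg_le_abs _)
  -- The step is zero up to `M`, which bounds the standard points of `J`, and positive beyond. The
  -- case of `-b` is its mirror image.
  · obtain ⟨M, hM⟩ := hfin.bddAbove
    refine ⟨fun x => Real.smoothTransition (x - M),
      Real.smoothTransition.contDiff.comp (contDiff_id.sub contDiff_const), ?_, hcases _ ?_ ?_ ?_⟩
    · have := N.T_of_eventually hb (P := fun x => ¬ Real.smoothTransition (x - M) = 0) M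
        (fun x hx => (Real.smoothTransition.pos_of_pos (sub_pos.2 hx)).ne')
      rwa [T_not, T_eq, lift_const] at this
    · exact fun r hr _ => Real.smoothTransition.zero_of_nonpos (sub_nonpos.2 (hM hr))
    · exact fun h => absurd rfl h
    · intro _
      rw [hneg]
      exact hb0 _ (-M) fun x hx => Real.smoothTransition.zero_of_nonpos (by linarith)
  · obtain ⟨M, hM⟩ := hfin.bddBelow
    refine ⟨fun x => Real.smoothTransition (M - x),
      Real.smoothTransition.contDiff.comp (contDiff_const.sub contDiff_id), ?_, hcases _ ?_ ?_ ?_⟩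
    · rw [hneg]
      have := N.T_of_eventually hb (P := fun x => ¬ Real.smoothTransition (M - -x) = 0) (-M)
        (fun x hx => (Real.smoothTransition.pos_of_pos (by linarith)).ne')
      rwa [T_not, T_eq, lift_const] at this
    · exact fun r hr _ => Real.smoothTransition.zero_of_nonpos (sub_nonpos.2 (hM hr))
    · exact fun _ => hb0 _ M fun x hx => Real.smoothTransition.zero_of_nonpos (by linarith)
    · exact fun h => absurd rfl h

/-- The empty set is standard, and adjoining one point is a transferred operation. -/
theorem exists_internal_of_finite {α : Type} [RealCode α] [Faithful α] {J : Set (N.Star α)}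
    (hJ : J.Finite) : ∃ F : N.Star (Set α), ∀ x : N.Star α, x.1 ∈ F.1 ↔ x ∈ J := by
  induction J, hJ using Set.Finite.induction_on with
  | empty =>
    refine ⟨N.std ∅, fun x => ?_⟩
    have := N.T_of_forall (P := fun a : α => ¬ a ∈ (∅ : Set α)) (fun a => id) x
    rw [T_not, T_mem, lift_id, lift_const] at this
    exact iff_of_false this (Set.notMem_empty x)
  | @insert a J _ _ ih =>
    obtain ⟨F, hF⟩ := ih
    refine ⟨N.lift (fun p : α × Set α => {x | x = p.1 ∨ x ∈ p.2}) (N.pr a F), fun x => ?_⟩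
    rw [N.mem_lift_setOf (Q := fun (p : α × Set α) x => x = p.1 ∨ x ∈ p.2)]
    simp [hF]

theorem basicPoints_mem_interval {b : N.Star ℝ} (hb : N.IsPosInfinite b.1) {x : N.Star ℝ}
    (hx : x ∈ N.basicPoints b) : N.HLe (N.neg b).1 x.1 ∧ N.HLe x.1 b.1 := by
  rcases hx with ⟨r, rfl⟩ | rfl | rfl
  · have := N.T_of_eventually hb (P := fun x => -x ≤ r ∧ r ≤ x) |r| fun x hx =>
      ⟨by linarith [neg_abs_le r], (le_abs_self r).trans hx.le⟩
    rwa [T_and, T_le, T_le, lift_neg, lift_const, lift_id] at this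
  · have := N.T_of_eventually hb (P := fun x => -x ≤ x ∧ x ≤ x) 0 fun x hx =>
      ⟨by linarith, le_rfl⟩
    rwa [T_and, T_le, T_le, lift_neg, lift_id] at this
  · have := N.T_of_eventually hb (P := fun x => -x ≤ -x ∧ -x ≤ x) 0 fun x hx =>
      ⟨le_rfl, by linarith⟩
    rwa [T_and, T_le, T_le, lift_neg, lift_id] at this

/-- The finite intersection property. The finite set `J` is replaced by an internal `F` with the
same elements, and the separating functions belong to the span because they are standard and `L`
contains every standard function. -/
theorem exists_deltaBasis_of_finite {L : N.Star (Set (Set (ℝ × ℝ)))}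
    (hL : N.IsHyperfiniteFunctionSet L.1) (hLσ : ∀ f : ℝ → ℝ, N.ext (realGraph f) ∈ L.1)
    {b : N.Star ℝ} (hb : N.IsPosInfinite b.1) {J : Set (N.Star ℝ)} (hJ : J.Finite)
    (hJb : J ⊆ N.basicPoints b) :
    ∃ d : N.Star (Set (ℝ × Set (ℝ × ℝ))),
      N.T (fun p : (Set (Set (ℝ × ℝ)) × ℝ) × Set (ℝ × Set (ℝ × ℝ)) =>
        StdDeltaBasis p.1.1 p.1.2 p.2) (N.pr (N.pr L b) d) ∧
      ∀ a ∈ J, ∃ e : N.Star (Set (ℝ × ℝ)), pair a.1 e.1 ∈ d.1 := by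
  obtain ⟨F, hF⟩ := N.exists_internal_of_finite hJ
  have hc1 : ∀ f : ℝ → ℝ, ContDiff ℝ 1 f → (N.std (realGraph f)).1 ∈ (N.lift c1Span L).1 := by
    intro f hf
    have := N.T_of_forall (P := fun A : Set (Set (ℝ × ℝ)) => realGraph f ∈ A →
      realGraph f ∈ c1Span A) (fun A hA => ⟨f, Submodule.subset_span ⟨hf, hA⟩, rfl⟩) L
    rw [T_imp, T_mem, T_mem, lift_const, lift_id] at this
    exact this (hLσ f)
  have hgraph : ∀ (f : ℝ → ℝ) (x : N.Star ℝ),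
      pair x.1 (N.lift f x).1 ∈ (N.std (realGraph f)).1 := N.lift_spec
  -- The statement is spelled with explicit quantifiers and negations, so that the rules for `T`
  -- unfold it completely.
  have key := N.T_of_forall (P := fun p : (Set (Set (ℝ × ℝ)) × ℝ) × Set ℝ =>
    p.1.1 ∈ finiteFunctionSets → 0 < p.1.2 →
    (∀ a : ℝ, a ∈ p.2 → -p.1.2 ≤ a ∧ a ≤ p.1.2) →
    (∀ a : ℝ, a ∈ p.2 → ∃ u, u ∈ c1Span p.1.1 ∧ (∃ y : ℝ, ¬ y = 0 ∧ (a, y) ∈ u) ∧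
      ∀ x : ℝ, x ∈ p.2 → ¬ x = a → (x, (0 : ℝ)) ∈ u) →
    ∃ d, StdDeltaBasis p.1.1 p.1.2 d ∧ ∀ a : ℝ, a ∈ p.2 → ∃ e, (a, e) ∈ d)
    (fun p h1 h2 h3 h4 => exists_stdDeltaBasis h1.2 h2 h3 h4) (N.pr (N.pr L b) F)
  simp [hF] at key
  obtain ⟨d, hd, hdJ⟩ := key hL (N.std_lt_of_isPosInfinite hb 0)
    (fun a ha => N.basicPoints_mem_interval hb (hJb ha)) (by
      intro a ha
      obtain ⟨f, hf, hfa, hfx⟩ := N.exists_separating hb hJ hJb (hJb ha)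
      refine ⟨N.std (realGraph f), hc1 f hf, ⟨_, hfa, hgraph f a⟩, fun x hx hxa => ?_⟩
      have := hgraph f x
      rwa [hfx x hx hxa] at this)
  refine ⟨d, ?_, hdJ⟩
  rw [N.T_comp (P := fun p : (Set (Set (ℝ × ℝ)) × ℝ) × Set (ℝ × Set (ℝ × ℝ)) =>
    StdDeltaBasis p.1.1 p.1.2 p.2) (fun p : ((Set (Set (ℝ × ℝ)) × ℝ) × Set ℝ) ×
      Set (ℝ × Set (ℝ × ℝ)) => (p.1.1, p.2))] at hd
  simpa using hd

theorem mk_basicPoints_le (b : N.Star ℝ) :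
    Cardinal.mk (N.basicPoints b) ≤ 2 ^ Cardinal.continuum := by
  have h1 : Cardinal.mk (Set.range (N.std (α := ℝ))) ≤ Cardinal.continuum := by
    have := Cardinal.mk_range_le_lift (f := N.std (α := ℝ))
    simpa [Cardinal.mk_real] using this
  have h2 : Cardinal.mk ({b, N.neg b} : Set (N.Star ℝ)) ≤ Cardinal.continuum :=
    ((Set.toFinite _).lt_aleph0.le).trans Cardinal.aleph0_le_continuum
  refine (Cardinal.mk_union_le _ _).trans ((add_le_add h1 h2).trans ?_)
  rw [Cardinal.continuum_add_self]
  exact (Cardinal.cantor _).le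

end NonstandardExtension

/-! ### Conclusion by saturation -/

theorem mainTheorem8 {Y : Type u} (N : NonstandardExtension Y)
    (hN : N.IsSaturated (2 ^ Cardinal.continuum))
    (Λ : Superstructure Y) (hΛ : N.IsHyperfiniteFunctionSet Λ)
    (hΛσ : ∀ f : ℝ → ℝ, N.ext (realGraph f) ∈ Λ)
    (β : Superstructure Y) (hβ : N.IsPosInfinite β) :
    ∃ S : Superstructure Y, N.IsIndependentSet Λ β S ∧
      (∀ x ∈ S, x ∈ N.interval β) ∧
      (∀ r : ℝ, N.ext r ∈ S) ∧ N.hneg β ∈ S ∧ β ∈ S := by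
  obtain ⟨L, rfl⟩ : ∃ L : N.Star (Set (Set (ℝ × ℝ))), Λ = L.1 := ⟨⟨Λ, N.mem_ext_univ hΛ⟩, rfl⟩
  obtain ⟨b, rfl⟩ : ∃ b : N.Star ℝ, β = b.1 := ⟨⟨β, N.mem_univ_real hβ.1⟩, rfl⟩
  -- `K x` is the internal set of Delta-bases whose index set contains `x`.
  let K : N.Star ℝ → N.Star (Set (Set (ℝ × Set (ℝ × ℝ)))) := fun x =>
    N.lift (fun p : (Set (Set (ℝ × ℝ)) × ℝ) × ℝ =>
      {d | StdDeltaBasis p.1.1 p.1.2 d ∧ ∃ e, (p.2, e) ∈ d}) (N.pr (N.pr L b) x)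
  have hK : ∀ (x : N.Star ℝ) (d : N.Star (Set (ℝ × Set (ℝ × ℝ)))), d.1 ∈ (K x).1 ↔
      N.T (fun p : (Set (Set (ℝ × ℝ)) × ℝ) × Set (ℝ × Set (ℝ × ℝ)) =>
        StdDeltaBasis p.1.1 p.1.2 p.2) (N.pr (N.pr L b) d) ∧
      ∃ e : N.Star (Set (ℝ × ℝ)), pair x.1 e.1 ∈ d.1 := by
    intro x d
    rw [N.mem_lift_setOf (Q := fun (p : (Set (Set (ℝ × ℝ)) × ℝ) × ℝ) d =>
      StdDeltaBasis p.1.1 p.1.2 d ∧ ∃ e, (p.2, e) ∈ d), NonstandardExtension.T_and]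
    rw [N.T_comp (P := fun p : (Set (Set (ℝ × ℝ)) × ℝ) × Set (ℝ × Set (ℝ × ℝ)) =>
      StdDeltaBasis p.1.1 p.1.2 p.2) (fun p : ((Set (Set (ℝ × ℝ)) × ℝ) × ℝ) ×
        Set (ℝ × Set (ℝ × ℝ)) => (p.1.1, p.2))]
    simp
  obtain ⟨d, hd⟩ := hN ((fun x => (K x).1) '' N.basicPoints b)
    (by
      rintro _ ⟨x, -, rfl⟩
      exact ⟨N.isInternal_val _, N.isSet_val _⟩)
    (Cardinal.mk_image_le.trans (N.mk_basicPoints_le b)) (by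
      intro G hG hfin
      obtain ⟨J, hJ, hJfin, rfl⟩ := Set.exists_subset_image_finite_and.1 ⟨G, hG, hfin, rfl⟩
      obtain ⟨d, hd, hdJ⟩ := N.exists_deltaBasis_of_finite hΛ hΛσ hβ hJfin hJ
      refine ⟨d.1, ?_⟩
      rintro _ ⟨x, hx, rfl⟩
      exact (hK x d).2 ⟨hd, hdJ x hx⟩)
  rw [Set.forall_mem_image] at hd
  -- Saturation yields only an element of `V(Y)`; it is internal because it lies in the internal set
  -- `K b`.
  obtain ⟨d, rfl⟩ := N.exists_val_of_mem (hd (Or.inr (Or.inl rfl) : b ∈ N.basicPoints b))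
  have hbasis := N.isDeltaBasis_of_T ((hK _ d).1 (hd (Or.inr (Or.inl rfl)))).1
  have hmem : ∀ x ∈ N.basicPoints b,
      x.1 ∈ (N.lift (fun d : Set (ℝ × Set (ℝ × ℝ)) => {a | ∃ e, (a, e) ∈ d}) d).1 := by
    intro x hx
    obtain ⟨e, he⟩ := ((hK x d).1 (hd hx)).2
    exact (hbasis.2.2.1 _).2 ⟨_, he⟩
  refine ⟨_, ⟨d.1, hbasis⟩, hbasis.2.1, fun r => hmem (N.std r) (Or.inl ⟨r, rfl⟩), ?_,
    hmem b (Or.inr (Or.inl rfl))⟩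
  rw [N.hneg_val]
  exact hmem (N.neg b) (Or.inr (Or.inr rfl))
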